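/- Notation. Let $\mathbb H$ be the Heisenberg group of the matrices $$M(x,y,z)=\begin{bmatrix}1&x&-y&z\\0&1&0&y\\0&0&1&0\\0&0&0&1\end{bmatrix},\qquad x,y,z\in\mathbb R,$$ with Haar measure $dn=dx\,dy\,dz$, and let $(\tau(u,v)f)(n)=f(u^{-1}nv)$ be the biregular representation of $\mathbb H\times\mathbb H$ on $L^2(\mathbb H)$. For $\lambda\in\mathbb R^*=\mathbb R\setminus\{0\}$ let $\pi_\lambda$ be the Schrödinger representation on $L^2(\mathbb R)$, $$(\pi_\lambda(M(x,y,z))g)(t)=e^{2\pi i\lambda z}e^{-2\pi i\lambda yt}g(t-x),$$ and let $\overline\pi_\lambda(n)=\pi_\lambda(n^{-1})^{tr}$ be its contragredient, where $tr$ is the transpose for the bilinear pairing $(u,v)\mapsto\int uv$. Identify $L^2(\mathbb R)\otimes L^2(\mathbb R)$ with the Hilbert–Schmidt operators on $L^2(\mathbb R)$, $a\otimes b$ being the operator $w\mapsto(\int bw)\,a$. The Plancherel transform $$\mathbf P:L^2(\mathbb H)\to\int_{\mathbb R^*}^{\oplus}L^2(\mathbb R)\otimes L^2(\mathbb R)\,|\lambda|\,d\lambda$$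 is the unitary operator that extends the group Fourier transform $f\mapsto\int_{\mathbb H}f(n)\pi_\lambda(n)\,dn$ from $L^1(\mathbb H)\cap L^2(\mathbb H)$ to $L^2(\mathbb H)$. For measurable $\mathcal S\subseteq\mathbb R^*$ put $$\mathbf H_{\mathcal S}=\mathbf P^{-1}\Big(\int_{\mathcal S}^{\oplus}L^2(\mathbb R)\otimes L^2(\mathbb R)\,|\lambda|\,d\lambda\Big).$$ Let $$\Lambda=\{(M(k_3,k_2,k_1),M(m_3,m_2,0)):k_1,k_2,k_3,m_2,m_3\in\mathbb Z\},$$ $$\Lambda_1=\{(M(k_3,k_2,0),M(m_3,m_2,0)):k_2,k_3,m_2,m_3\in\mathbb Z\}.$$ Two sets $I,J\subseteq\mathbb R$ are translation congruent if, after changing each of them by a Lebesgue null set, there are a bijection $\rho:I\to J$ and a function $k:I\to\mathbb Z$ with $\rho(\lambda)=\lambda+k(\lambda)$. A family $(x_i)_{i\in I}$ in a Hilbert space $K$ is a Parseval frame in $K$ if $\sum_{i\in I}|\langle h,x_i\rangle|^2=\|h\|^2$ for all $h\in K$. Theorem. Let $\mathcal S\subseteq\mathbb R^*$ be measurable and translation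 congruent to $(0,1]$, and let $f\in\mathbf H_{\mathcal S}$. If $\{\tau(\gamma,\eta)f:(\gamma,\eta)\in\Lambda\}$ is a Parseval frame in $\mathbf H_{\mathcal S}$, then for $d\lambda$-almost every $\lambda\in\mathcal S$ the system $$\big\{[\pi_\lambda(\kappa)\otimes\overline\pi_\lambda(\eta)]\,(\mathbf Pf)(\lambda)\,|\lambda|^{1/2}:(\kappa,\eta)\in\Lambda_1\big\}$$ is a Parseval frame in $L^2(\mathbb R)\otimes L^2(\mathbb R)$. -/

import Mathlib

open MeasureTheory Filter Topology TensorProduct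

noncomputable section

/-! ### Translation congruence and Parseval frames -/

/-- `I` and `J` are translation congruent: up to Lebesgue null sets, some bijection from `I` onto
`J` moves every point by an integer. -/
def TranslationCongruent (I J : Set ℝ) : Prop :=
  ∃ I' J' : Set ℝ, I' =ᵐ[volume] I ∧ J' =ᵐ[volume] J ∧
    ∃ (ρ : ℝ → ℝ) (k : ℝ → ℤ), Set.BijOn ρ I' J' ∧ ∀ t ∈ I', ρ t = t + k t

/-- The family `x` is a Parseval frame in the (closed, linear) subspace `K`: its members lie
in `K` and `∑ i, |⟨h, x i⟩|² = ‖h‖²` for every `h ∈ K`. -/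
def IsParsevalFrame {E ι : Type*} [NormedAddCommGroup E] [InnerProductSpace ℂ E]
    (K : Set E) (x : ι → E) : Prop :=
  (∀ i, x i ∈ K) ∧ ∀ h ∈ K, HasSum (fun i => ‖inner ℂ (x i) h‖ ^ 2) (‖h‖ ^ 2)

/-! ### The Heisenberg group -/

/-- The Heisenberg group. The element `⟨x, y, z⟩` is
`M(x, y, z) = exp(zZ) exp(yY) exp(xX)`; see `Heisenberg.toMatrix`. -/
@[ext]
structure Heisenberg where
  x : ℝ
  y : ℝ
  z : ℝ

namespace Heisenberg

instance : Mul Heisenberg := ⟨fun g h => ⟨g.x + h.x, g.y + h.y, g.z + h.z + g.x * h.y⟩⟩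
instance : One Heisenberg := ⟨⟨0, 0, 0⟩⟩
instance : Inv Heisenberg := ⟨fun g => ⟨-g.x, -g.y, -g.z + g.x * g.y⟩⟩

theorem mul_def (g h : Heisenberg) :
    g * h = ⟨g.x + h.x, g.y + h.y, g.z + h.z + g.x * h.y⟩ := rfl
theorem one_def : (1 : Heisenberg) = ⟨0, 0, 0⟩ := rfl
theorem inv_def (g : Heisenberg) : g⁻¹ = ⟨-g.x, -g.y, -g.z + g.x * g.y⟩ := rfl

instance : Group Heisenberg where
  mul_assoc a b c := by ext <;> simp only [mul_def] <;> ring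
  one_mul a := by ext <;> simp [mul_def, one_def]
  mul_one a := by ext <;> simp [mul_def, one_def]
  inv_mul_cancel a := by ext <;> simp [mul_def, one_def, inv_def]

/-- The matrix `M(x, y, z)` of an element of the Heisenberg group. -/
def toMatrix (g : Heisenberg) : Matrix (Fin 4) (Fin 4) ℝ :=
  !![1, g.x, -g.y, g.z; 0, 1, 0, g.y; 0, 0, 1, 0; 0, 0, 0, 1]

theorem toMatrix_mul (g h : Heisenberg) : (g * h).toMatrix = g.toMatrix * h.toMatrix := by
  ext i j
  fin_cases i <;> fin_cases j <;>
    simp [toMatrix, mul_def, Matrix.mul_apply, Fin.sum_univ_four] <;> ring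

theorem toMatrix_injective : Function.Injective toMatrix := by
  intro g h e
  have hx := congrFun (congrFun e 0) 1
  have hy := congrFun (congrFun e 1) 3
  have hz := congrFun (congrFun e 0) 3
  simp [toMatrix] at hx hy hz
  ext <;> assumption

/-- The coordinates `(x, y, z)`. -/
def coords : Heisenberg ≃ ℝ × ℝ × ℝ where
  toFun g := (g.x, g.y, g.z)
  invFun p := ⟨p.1, p.2.1, p.2.2⟩
  left_inv _ := rfl
  right_inv _ := rfl

instance : MeasurableSpace Heisenberg := MeasurableSpace.comap coords inferInstance

/-- The coordinates as a measurable equivalence. -/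
def measurableCoords : Heisenberg ≃ᵐ ℝ × ℝ × ℝ where
  toEquiv := coords
  measurable_toFun := comap_measurable coords
  measurable_invFun := by
    rintro s ⟨t, ht, rfl⟩
    exact ht

/-- The canonical Haar measure: Lebesgue measure `dx dy dz`. -/
instance : MeasureSpace Heisenberg := ⟨Measure.map measurableCoords.symm volume⟩

theorem measurePreserving_coords_symm :
    MeasurePreserving measurableCoords.symm (volume : Measure (ℝ × ℝ × ℝ)) volume :=
  ⟨measurableCoords.symm.measurable, rfl⟩

theorem measurePreserving_coords :
    MeasurePreserving measurableCoords volume (volume : Measure (ℝ × ℝ × ℝ)) :=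
  measurePreserving_coords_symm.symm _

theorem measurePreserving_shear (a b c α β : ℝ) :
    MeasurePreserving
      (fun p : ℝ × ℝ × ℝ => (p.1 + a, p.2.1 + b, p.2.2 + (α * p.1 + β * p.2.1 + c)))
      volume volume := by
  have add_right (t : ℝ) : MeasurePreserving (fun s : ℝ => s + t) volume volume :=
    measurePreserving_add_right volume t
  have inner (x : ℝ) : MeasurePreserving
      (fun q : ℝ × ℝ => (q.1 + b, q.2 + (α * x + β * q.1 + c))) volume volume := by
    refine (add_right b).skew_product (g := fun y z => z + (α * x + β * y + c)) ?_ ?_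
    · fun_prop
    · exact Eventually.of_forall fun y => (add_right _).map_eq
  refine (add_right a).skew_product
    (g := fun x (q : ℝ × ℝ) => (q.1 + b, q.2 + (α * x + β * q.1 + c))) ?_ ?_
  · fun_prop
  · exact Eventually.of_forall fun x => (inner x).map_eq

/-- The Haar measure is invariant under `n ↦ u⁻¹ n v`. -/
theorem measurePreserving_inv_mul_mul (u v : Heisenberg) :
    MeasurePreserving (fun n : Heisenberg => u⁻¹ * n * v) volume volume := by
  have h := (measurePreserving_coords_symm.comp
    (measurePreserving_shear (-u.x + v.x) (-u.y + v.y)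
      (-u.z + u.x * u.y + v.z - u.x * v.y) (v.y) (-u.x))).comp measurePreserving_coords
  convert h using 1
  funext n
  ext <;> simp [mul_def, inv_def, measurableCoords, coords] <;> ring

/-- The Hilbert space `L²(ℍ)`. -/
abbrev L2 : Type := Lp ℂ 2 (volume : Measure Heisenberg)

/-- The biregular representation of `ℍ × ℍ` on `L²(ℍ)`:
`(τ(u, v) f)(n) = (L(u) R(v) f)(n) = f(u⁻¹ n v)`. -/
def biregular (u v : Heisenberg) : L2 →ₗᵢ[ℂ] L2 :=
  Lp.compMeasurePreservingₗᵢ ℂ (fun n => u⁻¹ * n * v) (measurePreserving_inv_mul_mul u v)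

/-- The set `Λ ⊆ ℍ × ℍ` of all pairs `(M(k₃, k₂, k₁), M(m₃, m₂, 0))` with integer entries. -/
def Lam : Set (Heisenberg × Heisenberg) :=
  {p | ∃ k₁ k₂ k₃ m₂ m₃ : ℤ, p = (⟨k₃, k₂, k₁⟩, ⟨m₃, m₂, 0⟩)}

/-- The set `Λ₁ ⊆ Λ` of all pairs `(M(k₃, k₂, 0), M(m₃, m₂, 0))` with integer entries. -/
def Lam₁ : Set (Heisenberg × Heisenberg) :=
  {p | ∃ k₂ k₃ m₂ m₃ : ℤ, p = (⟨k₃, k₂, 0⟩, ⟨m₃, m₂, 0⟩)}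

end Heisenberg

/-! ### Schrödinger representations -/

/-- The Hilbert space `L²(ℝ)`. -/
abbrev L2R : Type := Lp ℂ 2 (volume : Measure ℝ)

/-- The function `t ↦ e^{2πiλz} e^{-2πiλyt} f(t - x)`. -/
def schrodingerFun (lam : ℝ) (g : Heisenberg) (f : ℝ → ℂ) (t : ℝ) : ℂ :=
  Complex.exp (2 * Real.pi * Complex.I * lam * g.z) *
    Complex.exp (-2 * Real.pi * Complex.I * lam * g.y * t) * f (t - g.x)

theorem norm_schrodingerFun (lam : ℝ) (g : Heisenberg) (f : ℝ → ℂ) (t : ℝ) :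
    ‖schrodingerFun lam g f t‖ = ‖f (t - g.x)‖ := by
  simp [schrodingerFun, Complex.norm_exp]

theorem measurePreserving_sub_right_real (x : ℝ) :
    MeasurePreserving (fun t : ℝ => t - x) volume volume := by
  simpa [sub_eq_add_neg] using measurePreserving_add_right (volume : Measure ℝ) (-x)

theorem memLp_schrodingerFun (lam : ℝ) (g : Heisenberg) (f : L2R) :
    MemLp (schrodingerFun lam g f) 2 volume := by
  have h := (Lp.memLp f).comp_measurePreserving (measurePreserving_sub_right_real g.x)
  refine h.of_le (AEStronglyMeasurable.mul ?_ h.1) ?_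
  · exact Continuous.aestronglyMeasurable (by fun_prop)
  · exact Eventually.of_forall fun t => (norm_schrodingerFun lam g f t).le

/-- The Schrödinger representation `π_λ` of the Heisenberg group on `L²(ℝ)`:
`(π_λ(M(x, y, z)) f)(t) = e^{2πiλz} e^{-2πiλyt} f(t - x)`. -/
def schrodinger (lam : ℝ) (g : Heisenberg) : L2R →ₗᵢ[ℂ] L2R where
  toFun f := (memLp_schrodingerFun lam g f).toLp _
  map_add' f₁ f₂ := by
    rw [← MemLp.toLp_add]
    apply MemLp.toLp_congr
    have h := (measurePreserving_sub_right_real g.x).quasiMeasurePreserving.ae (Lp.coeFn_add f₁ f₂)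
    filter_upwards [h] with t ht
    simp only [schrodingerFun, Pi.add_apply, ht]
    ring
  map_smul' c f := by
    rw [RingHom.id_apply, ← MemLp.toLp_const_smul]
    apply MemLp.toLp_congr
    have h := (measurePreserving_sub_right_real g.x).quasiMeasurePreserving.ae (Lp.coeFn_smul c f)
    filter_upwards [h] with t ht
    simp only [schrodingerFun, Pi.smul_apply, ht, smul_eq_mul]
    ring
  norm_map' f := by
    change ‖(memLp_schrodingerFun lam g f).toLp _‖ = ‖f‖
    have h := measurePreserving_sub_right_real g.x
    rw [Lp.norm_toLp, Lp.norm_def,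
      ← eLpNorm_comp_measurePreserving (Lp.aestronglyMeasurable f) h]
    congr 1
    exact eLpNorm_congr_norm_ae
      (Eventually.of_forall fun t => norm_schrodingerFun lam g f t)

theorem coeFn_schrodinger (lam : ℝ) (g : Heisenberg) (f : L2R) :
    schrodinger lam g f =ᵐ[volume] schrodingerFun lam g f :=
  MemLp.coeFn_toLp (memLp_schrodingerFun lam g f)

/-- Complex conjugation `f ↦ f̄` on `L²(ℝ)`. -/
def conjL2R : L2R →ₗᵢ⋆[ℂ] L2R where
  toFun f := star f
  map_add' f₁ f₂ := by
    apply Lp.ext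
    filter_upwards [Lp.coeFn_star (f₁ + f₂), Lp.coeFn_add f₁ f₂, Lp.coeFn_star f₁,
      Lp.coeFn_star f₂, Lp.coeFn_add (star f₁) (star f₂)] with t h h₁ h₂ h₃ h₄
    simp only [h, h₁, h₂, h₃, h₄, Pi.star_apply, Pi.add_apply, star_add]
  map_smul' c f := by
    apply Lp.ext
    filter_upwards [Lp.coeFn_star (c • f), Lp.coeFn_smul c f, Lp.coeFn_star f,
      Lp.coeFn_smul (starRingEnd ℂ c) (star f)] with t h h₁ h₂ h₃
    rw [h, h₃, Pi.star_apply, h₁, Pi.smul_apply, Pi.smul_apply, h₂, Pi.star_apply,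
      smul_eq_mul, smul_eq_mul, star_mul', starRingEnd_apply]
  norm_map' f := by
    change ‖star f‖ = ‖f‖
    rw [Lp.norm_def, Lp.norm_def]
    congr 1
    apply eLpNorm_congr_norm_ae
    filter_upwards [Lp.coeFn_star f] with t h
    simp [h]

/-- The transpose of a bounded operator on `L²(ℝ)` with respect to the bilinear pairing
`(u, v) ↦ ∫ u v` (which identifies `L²(ℝ)` with its dual), that is `v ↦ conj (T* (conj v))`. -/
def transposeL2R (T : L2R →L[ℂ] L2R) : L2R →L[ℂ] L2R :=
  (conjL2R.toContinuousLinearMap.comp (ContinuousLinearMap.adjoint T)).comp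
    conjL2R.toContinuousLinearMap

/-- The contragredient representation `π̄_λ(g) = π_λ(g⁻¹)ᵗʳ`. -/
def contragredient (lam : ℝ) (g : Heisenberg) : L2R →L[ℂ] L2R :=
  transposeL2R (schrodinger lam g⁻¹).toContinuousLinearMap

/-- The Hilbert space tensor product `L²(ℝ) ⊗ L²(ℝ)`: the completion of the algebraic tensor
product for the inner product with `⟨a ⊗ b, c ⊗ d⟩ = ⟨a, c⟩ ⟨b, d⟩`. -/
abbrev L2Tensor : Type := UniformSpace.Completion (L2R ⊗[ℂ] L2R)

/-- The operator `π_λ(κ) ⊗ π̄_λ(η)` on `L²(ℝ) ⊗ L²(ℝ)`. -/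
def tensorRep (lam : ℝ) (κ η : Heisenberg) : L2Tensor →L[ℂ] L2Tensor :=
  (TensorProduct.mapL (schrodinger lam κ).toContinuousLinearMap
    (contragredient lam η)).completion

/-- An element `T` of `L²(ℝ) ⊗ L²(ℝ)` is identified with a Hilbert-Schmidt operator on `L²(ℝ)`,
`a ⊗ b` being the rank-one operator `u ↦ (∫ b u) a`. This is the matrix coefficient `⟨T u, v⟩`
(linear in `u`, conjugate linear in `v`) of that operator: by `⟨a, v⟩ ∫ b u = ⟨a ⊗ b, v ⊗ ū⟩` it
is the inner product of `T` with `v ⊗ ū`. -/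
def matrixCoeff (T : L2Tensor) (u v : L2R) : ℂ :=
  inner ℂ ((v ⊗ₜ[ℂ] conjL2R u : L2R ⊗[ℂ] L2R) : L2Tensor) T

theorem matrixCoeff_tmul (a b u v : L2R) :
    matrixCoeff ((a ⊗ₜ[ℂ] b : L2R ⊗[ℂ] L2R) : L2Tensor) u v =
      inner ℂ v a * ∫ t, b t * u t := by
  rw [matrixCoeff, UniformSpace.Completion.inner_coe, TensorProduct.inner_tmul, L2.inner_def]
  congr 1
  apply integral_congr_ae
  filter_upwards [Lp.coeFn_star u] with t ht
  change inner ℂ ((star u : L2R) t) (b t) = _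
  simp [ht]

/-! ### The Plancherel transform -/

/-- The Plancherel measure `|λ| dλ`. The point `0` is a null set, so that this is a measure on
the punctured line. -/
def plancherelMeasure : Measure ℝ := volume.withDensity fun lam => ENNReal.ofReal |lam|

/-- The direct integral `∫^⊕ L²(ℝ) ⊗ L²(ℝ) |λ| dλ` over the punctured line. The fibre being
constant, it is the `L²` space of functions with values in `L²(ℝ) ⊗ L²(ℝ)`. -/
abbrev PlancherelSpace : Type := Lp L2Tensor 2 plancherelMeasure

/-- `f ∈ L¹(ℍ) ∩ L²(ℍ)` and `Φ` is its operator-valued Fourier transform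
`λ ↦ ∫ f(n) π_λ(n) dn`, the integral being taken in the weak sense. -/
def IsGroupFourierTransform (f : Heisenberg.L2) (Φ : PlancherelSpace) : Prop :=
  Integrable f ∧ ∀ᵐ lam : ℝ, ∀ u v : L2R,
    matrixCoeff (Φ lam) u v = ∫ n, f n * inner ℂ v (schrodinger lam n u)

/-- `Φ` is the Plancherel transform of `f`: the pair `(f, Φ)` is a limit of pairs `(g, Ψ)` with
`g ∈ L¹(ℍ) ∩ L²(ℍ)` and `Ψ` the Fourier transform of `g`. -/
def IsPlancherelTransform (f : Heisenberg.L2) (Φ : PlancherelSpace) : Prop :=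
  (f, Φ) ∈ closure {p : Heisenberg.L2 × PlancherelSpace | IsGroupFourierTransform p.1 p.2}

open scoped Classical in
/-- The Plancherel transform `P`, the extension by continuity to `L²(ℍ)` of the group Fourier
transform on `L¹(ℍ) ∩ L²(ℍ)`. (Every `f` has exactly one Plancherel transform, by the Plancherel
theorem.) -/
def plancherel (f : Heisenberg.L2) : PlancherelSpace :=
  if h : ∃ Φ, IsPlancherelTransform f Φ then h.choose else 0

/-- The space `H_S = P⁻¹(∫_S^⊕ L²(ℝ) ⊗ L²(ℝ) |λ| dλ)` of those `f ∈ L²(ℍ)` whose Plancherel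
transform vanishes almost everywhere outside `S`. -/
def bandlimitedSpace (S : Set ℝ) : Set Heisenberg.L2 :=
  {f | ∀ᵐ lam : ℝ, lam ∉ S → plancherel f lam = 0}

end

noncomputable section

/-! ### Fourier transforms on the line -/

section Fourier

open FourierTransform SchwartzMap
open scoped ContDiff

/-! Under the Plancherel transform, τ(κ, η) acts fibrewise as π_λ(κ) ⊗ π̄_λ(η), and the central
element M(0, 0, k) acts as the scalar e^{2πikλ}. Since Λ is Λ₁ times the integral centre, the
Parseval sum over Λ can be summed over k first. When it is tested against a vector h with transform
1_A(λ) w, A ⊆ S bounded, the inner sum consists of the squared Fourier coefficients of λ ↦ 1_A(λ)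
|λ| ⟨w, P(τ(p) f)(λ)⟩. Because S is a set of representatives of ℝ/ℤ up to null sets, Parseval's
identity for Fourier series (`tsum_enorm_sq_setIntegral_exp`) turns this sum into an integral over
A. The frame identity becomes ∫_A ∑_p |λ|² |⟨w, P(τ(p) f)(λ)⟩|² dλ = ∫_A |λ| ‖w‖² dλ. As A is
arbitrary the integrands agree almost everywhere, and dividing by |λ| gives the fibrewise identity
with the factor |λ|^{1/2}. A countable dense set of w, followed by an extension by continuity
(`tsum_enorm_inner_sq_of_dense`), removes the dependence of the null set on w.

The analytic input is the Plancherel transform itself. The inversion formula defines an isometry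
`inversePlancherel` on the Plancherel space: its norm computation
(`lintegral_enorm_inverseTransformFun_sq`) reduces to Plancherel's theorem on the line, used in z
and in y. The adjoint `plancherelCLM` agrees with the group Fourier transform on L¹ ∩ L² by Fubini,
hence is the Plancherel transform (`plancherel_eq`). It is a left inverse of the isometry, which
provides enough test vectors h; surjectivity of the isometry is not needed. -/

theorem fourier_toLp_ae_eq {g : ℝ → ℂ} (h₁ : Integrable g) (h₂ : MemLp g 2 volume) :
    (𝓕 (h₂.toLp g) : Lp ℂ 2 (volume : Measure ℝ)) =ᵐ[volume] 𝓕 g := by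
  refine ae_eq_of_integral_contDiff_smul_eq
    ((Lp.memLp _).locallyIntegrable one_le_two) ?_ fun φ hφ hφc => ?_
  · exact (VectorFourier.fourierIntegral_continuous Real.continuous_fourierChar
      (by fun_prop) h₁).locallyIntegrable
  · have hc : HasCompactSupport (Complex.ofRealCLM ∘ φ) := hφc.comp_left rfl
    set ψ : 𝓢(ℝ, ℂ) := hc.toSchwartzMap (Complex.ofRealCLM.contDiff.comp hφ) with hψ
    have hval (x : ℝ) : ψ x = (φ x : ℂ) := rfl
    -- The L² transform is compatible with that of tempered distributions, so pairing it with ψ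
    -- moves the transform onto ψ; the multiplication formula for L¹ functions moves it back onto g.
    have key := congrArg (fun T => T ψ) (Lp.fourier_toTemperedDistribution_eq (h₂.toLp g))
    simp only [TemperedDistribution.fourier_apply, Lp.toTemperedDistribution_apply] at key
    have hflip : ∫ x, 𝓕 (ψ : ℝ → ℂ) x • g x = ∫ x, ψ x • 𝓕 g x := by
      have := VectorFourier.integral_fourierIntegral_smul_eq_flip (L := innerₗ ℝ)
        (μ := volume) (ν := volume) Real.continuous_fourierChar (by fun_prop) ψ.integrable h₁
      rwa [flip_innerₗ] at this
    calc ∫ x, φ x • (𝓕 (h₂.toLp g) : Lp ℂ 2 (volume : Measure ℝ)) x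
        = ∫ x, ψ x • (𝓕 (h₂.toLp g) : Lp ℂ 2 (volume : Measure ℝ)) x := by
          simp [hval]
      _ = ∫ x, 𝓕 (ψ : ℝ → ℂ) x • g x := by
          rw [← key]
          refine integral_congr_ae ?_
          filter_upwards [h₂.coeFn_toLp] with x hx
          rw [hx, SchwartzMap.fourier_coe]
      _ = ∫ x, φ x • 𝓕 g x := by
          rw [hflip]
          simp [hval]

/-- Plancherel's theorem on `L¹ ∩ L²`. -/
theorem lintegral_enorm_fourier_sq {g : ℝ → ℂ} (h₁ : Integrable g) (h₂ : MemLp g 2 volume) :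
    ∫⁻ ξ, ‖𝓕 g ξ‖ₑ ^ 2 = ∫⁻ x, ‖g x‖ₑ ^ 2 := by
  have h : eLpNorm (𝓕 g) 2 volume = eLpNorm g 2 volume := by
    rw [← eLpNorm_congr_ae (fourier_toLp_ae_eq h₁ h₂), ← Lp.enorm_def,
      ← eLpNorm_congr_ae h₂.coeFn_toLp, ← Lp.enorm_def, ← ofReal_norm, ← ofReal_norm,
      Lp.norm_fourier_eq]
  have sq (f : ℝ → ℂ) : ∫⁻ x, ‖f x‖ₑ ^ 2 = eLpNorm f 2 volume ^ 2 := by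
    have := eLpNorm_nnreal_pow_eq_lintegral (μ := volume) (f := f) (p := 2) two_ne_zero
    simpa using this.symm
  rw [sq, sq, h]

/-- Plancherel's theorem for the rescaled Fourier transform `y ↦ ∫ g(t) e^{-2πi s y t} dt`. -/
theorem lintegral_enorm_fourier_mul_sq {g : ℝ → ℂ} (h₁ : Integrable g) (h₂ : MemLp g 2 volume)
    {s : ℝ} (hs : s ≠ 0) :
    ENNReal.ofReal |s| * ∫⁻ y, ‖𝓕 g (s * y)‖ₑ ^ 2 = ∫⁻ x, ‖g x‖ₑ ^ 2 := by
  have hc : Continuous (𝓕 g) :=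
    VectorFourier.fourierIntegral_continuous Real.continuous_fourierChar (by fun_prop) h₁
  have hm : Measurable fun y => ‖𝓕 g y‖ₑ ^ 2 := (hc.measurable.enorm).pow_const 2
  rw [← lintegral_enorm_fourier_sq h₁ h₂, ← lintegral_map (μ := volume) hm
    (measurable_const_mul s), ← smul_eq_mul,
    ← lintegral_smul_measure]
  conv_rhs => rw [← Real.smul_map_volume_mul_left hs]

end Fourier

/-! ### Polarization -/

section Polarization

variable {X Y Z H H' : Type*} [AddCommGroup X] [Module ℂ X] [AddCommGroup Y] [Module ℂ Y]
  [AddCommGroup Z] [Module ℂ Z] [NormedAddCommGroup H] [InnerProductSpace ℂ H]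
  [NormedAddCommGroup H'] [InnerProductSpace ℂ H']

/-- Polarization for a sesquilinear form that need not be Hermitian: its diagonal at x + y and x +
iy determines it. Allowing f₁ ≠ f₂ is what makes iteration over several variables possible. -/
theorem inner_eq_inner_of_diagonal {f₁ f₂ : X →ₗ[ℂ] H} {g₁ g₂ : X →ₗ[ℂ] H'}
    (h : ∀ x, inner ℂ (f₁ x) (f₂ x) = inner ℂ (g₁ x) (g₂ x)) (x y : X) :
    inner ℂ (f₁ x) (f₂ y) = inner ℂ (g₁ x) (g₂ y) := by
  have h1 := h (x + y)
  have h2 := h (x + Complex.I • y)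
  simp only [map_add, map_smul, inner_add_left, inner_add_right, inner_smul_left,
    inner_smul_right, Complex.conj_I] at h1 h2
  linear_combination (1 / 2) * h1 - (Complex.I / 2) * h2 -
    (1 / 2 - Complex.I / 2) * h x - (1 / 2 - Complex.I / 2) * h y +
    (1 / 2) * (inner ℂ (f₁ x) (f₂ y) - inner ℂ (f₁ y) (f₂ x) - Complex.I * inner ℂ (f₁ y) (f₂ y)
      - (inner ℂ (g₁ x) (g₂ y) - inner ℂ (g₁ y) (g₂ x) - Complex.I * inner ℂ (g₁ y) (g₂ y)))
      * Complex.I_sq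

theorem inner_eq_inner_of_norm_eq {f : X →ₗ[ℂ] H} {g : X →ₗ[ℂ] H'}
    (h : ∀ x, ‖f x‖ = ‖g x‖) (x y : X) : inner ℂ (f x) (f y) = inner ℂ (g x) (g y) :=
  inner_eq_inner_of_diagonal (fun x => by simp [inner_self_eq_norm_sq_to_K, h]) x y

/-- One variable is polarized at a time. After the first, the other slots already hold different
vectors on the two sides, so the non-Hermitian form of polarization is required. -/
theorem inner_eq_inner_of_norm_eq₃ {f : X →ₗ[ℂ] Y →ₗ[ℂ] Z →ₗ[ℂ] H}
    {g : X →ₗ[ℂ] Y →ₗ[ℂ] Z →ₗ[ℂ] H'} (h : ∀ x y z, ‖f x y z‖ = ‖g x y z‖)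
    (x x' : X) (y y' : Y) (z z' : Z) :
    inner ℂ (f x y z) (f x' y' z') = inner ℂ (g x y z) (g x' y' z') := by
  have h₁ (x y z z') : inner ℂ (f x y z) (f x y z') = inner ℂ (g x y z) (g x y z') :=
    inner_eq_inner_of_norm_eq (h x y) z z'
  have h₂ (x y y' z z') : inner ℂ (f x y z) (f x y' z') = inner ℂ (g x y z) (g x y' z') :=
    inner_eq_inner_of_diagonal (f₁ := (f x).flip z) (f₂ := (f x).flip z')
      (g₁ := (g x).flip z) (g₂ := (g x).flip z') (fun y => h₁ x y z z') y y'
  exact inner_eq_inner_of_diagonal (f₁ := (f.flip y).flip z) (f₂ := (f.flip y').flip z')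
      (g₁ := (g.flip y).flip z) (g₂ := (g.flip y').flip z') (fun x => h₂ x y y' z z') x x'

/-- Two families with the same Gram matrix, the first one spanning a dense subspace, are related
by a linear isometry. -/
theorem exists_linearIsometry_of_inner_eq [CompleteSpace H'] {ι : Type*} {e : ι → H} {q : ι → H'}
    (he : Dense (Submodule.span ℂ (Set.range e) : Set H))
    (h : ∀ i j, inner ℂ (q i) (q j) = inner ℂ (e i) (e j)) :
    ∃ Q : H →ₗᵢ[ℂ] H', ∀ i, Q (e i) = q i := by
  set E := Finsupp.linearCombination ℂ e with hE
  set F := Finsupp.linearCombination ℂ q with hF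
  have hinner (m n) : inner ℂ (F m) (F n) = inner ℂ (E m) (E n) := by
    simp only [hE, hF, Finsupp.linearCombination_apply, Finsupp.sum, sum_inner, inner_sum,
      inner_smul_left, inner_smul_right, h]
  have hnorm (m) : ‖F m‖ = ‖E m‖ := by
    rw [← sq_eq_sq₀ (norm_nonneg _) (norm_nonneg _), ← inner_self_eq_norm_sq (𝕜 := ℂ),
      ← inner_self_eq_norm_sq (𝕜 := ℂ), hinner]
  have hd : DenseRange E := by
    rw [DenseRange, ← LinearMap.coe_range, hE, Finsupp.range_linearCombination]
    exact he
  have hb : ∃ C, ∀ x, ‖F x‖ ≤ C * ‖E x‖ := ⟨1, fun x => by rw [hnorm, one_mul]⟩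
  refine ⟨⟨(F.extendOfNorm E).toLinearMap, fun x => ?_⟩, fun i => ?_⟩
  · refine hd.induction ?_ (isClosed_eq (by fun_prop) continuous_norm) x
    rintro _ ⟨m, rfl⟩
    exact (congrArg norm (LinearMap.extendOfNorm_eq hd hb m)).trans (hnorm m)
  · have := LinearMap.extendOfNorm_eq hd hb (Finsupp.single i 1)
    simpa [hE, hF] using this

end Polarization

/-! ### The Plancherel measure -/

instance : IsLocallyFiniteMeasure plancherelMeasure :=
  IsLocallyFiniteMeasure.withDensity_ofReal continuous_abs

theorem measurable_ofReal_abs : Measurable fun lam : ℝ => ENNReal.ofReal |lam| :=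
  ENNReal.measurable_ofReal.comp continuous_abs.measurable

/-- The density |λ| vanishes only at the Lebesgue null point 0, so the two measures have the same
null sets. -/
theorem ae_plancherelMeasure_iff {p : ℝ → Prop} :
    (∀ᵐ lam ∂plancherelMeasure, p lam) ↔ ∀ᵐ lam : ℝ, p lam := by
  rw [plancherelMeasure, ae_withDensity_iff measurable_ofReal_abs]
  have h0 : ∀ᵐ lam : ℝ, lam ≠ 0 := by simp [ae_iff, measure_singleton]
  refine ⟨fun h => ?_, fun h => h.mono fun _ hx _ => hx⟩
  filter_upwards [h, h0] with lam h h0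
  exact h (by simp [h0])

theorem lintegral_plancherelMeasure {g : ℝ → ENNReal} (hg : Measurable g) :
    ∫⁻ lam, g lam ∂plancherelMeasure = ∫⁻ lam, ENNReal.ofReal |lam| * g lam :=
  lintegral_withDensity_eq_lintegral_mul _ measurable_ofReal_abs hg

theorem integral_plancherelMeasure (g : ℝ → ℂ) :
    ∫ lam : ℝ, g lam ∂plancherelMeasure = ∫ lam : ℝ, ((|lam| : ℝ) : ℂ) * g lam := by
  have h := integral_withDensity_eq_integral_smul (μ := volume)
    (f := fun lam : ℝ => Real.toNNReal |lam|) (continuous_abs.measurable.real_toNNReal) g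
  refine h.trans (integral_congr_ae (Eventually.of_forall fun lam => ?_))
  simp [NNReal.smul_def]

theorem integrable_plancherelMeasure_iff {g : ℝ → ℂ} :
    Integrable g plancherelMeasure ↔ Integrable fun lam : ℝ => ((|lam| : ℝ) : ℂ) * g lam := by
  have h := integrable_withDensity_iff_integrable_smul (μ := volume)
    (f := fun lam : ℝ => Real.toNNReal |lam|) (continuous_abs.measurable.real_toNNReal) (g := g)
  refine h.trans (iff_of_eq (congrArg (fun F => Integrable F volume) (funext fun lam => ?_)))
  simp [NNReal.smul_def]

theorem lintegral_enorm_sq_eq_enorm_sq {α E : Type*} [MeasurableSpace α] {μ : Measure α}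
    [NormedAddCommGroup E] (f : α → E) :
    ∫⁻ x, ‖f x‖ₑ ^ 2 ∂μ = eLpNorm f 2 μ ^ 2 := by
  have := eLpNorm_nnreal_pow_eq_lintegral (μ := μ) (f := f) (p := 2) two_ne_zero
  simpa using this.symm

/-! ### Separability and density of elementary tensors -/

instance separableSpace_L2R : TopologicalSpace.SeparableSpace L2R :=
  haveI : Fact ((2 : ENNReal) ≠ ⊤) := ⟨ENNReal.ofNat_ne_top⟩
  inferInstance

/-- The elementary tensor `a ⊗ b` in `L²(ℝ) ⊗ L²(ℝ)`. -/
abbrev pureTensor (a b : L2R) : L2Tensor := ((a ⊗ₜ[ℂ] b : L2R ⊗[ℂ] L2R) : L2Tensor)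

theorem norm_pureTensor (a b : L2R) : ‖pureTensor a b‖ = ‖a‖ * ‖b‖ := by
  rw [pureTensor, UniformSpace.Completion.norm_coe, TensorProduct.norm_tmul]

theorem inner_pureTensor (a b c d : L2R) :
    inner ℂ (pureTensor a b) (pureTensor c d) = inner ℂ a c * inner ℂ b d := by
  rw [pureTensor, pureTensor, UniformSpace.Completion.inner_coe, TensorProduct.inner_tmul]

/-- The bilinear map `(a, b) ↦ a ⊗ b`. -/
def pureTensorₗ : L2R →ₗ[ℂ] L2R →ₗ[ℂ] L2Tensor :=
  (TensorProduct.mk ℂ L2R L2R).compr₂ (UniformSpace.Completion.toComplL (𝕜 := ℂ)).toLinearMap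

theorem pureTensorₗ_apply (a b : L2R) : pureTensorₗ a b = pureTensor a b := rfl

theorem continuous_pureTensor : Continuous fun p : L2R × L2R => pureTensor p.1 p.2 := by
  have h : ∀ a b, ‖pureTensorₗ a b‖ ≤ 1 * ‖a‖ * ‖b‖ := fun a b => by
    rw [pureTensorₗ_apply, norm_pureTensor, one_mul]
  exact (pureTensorₗ.mkContinuous₂ 1 h).continuous₂

theorem dense_span_pureTensor :
    Dense (Submodule.span ℂ (Set.range fun p : L2R × L2R => pureTensor p.1 p.2) :
      Set L2Tensor) := by
  refine (UniformSpace.Completion.denseRange_coe (α := L2R ⊗[ℂ] L2R)).mono ?_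
  rintro _ ⟨t, rfl⟩
  induction t with
  | zero => exact zero_mem _
  | tmul a b => exact Submodule.subset_span ⟨(a, b), rfl⟩
  | add s t hs ht =>
    rw [UniformSpace.Completion.coe_add]
    exact add_mem hs ht

instance separableSpace_L2Tensor : TopologicalSpace.SeparableSpace L2Tensor := by
  rw [← TopologicalSpace.isSeparable_univ_iff, ← dense_span_pureTensor.closure_eq]
  exact ((TopologicalSpace.isSeparable_range continuous_pureTensor).span (R := ℂ)).closure

instance secondCountableTopology_L2Tensor : SecondCountableTopology L2Tensor :=
  UniformSpace.secondCountable_of_separable _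

theorem eq_zero_of_inner_pureTensor_eq_zero {x : L2Tensor}
    (h : ∀ a b, inner ℂ (pureTensor a b) x = 0) : x = 0 := by
  refine dense_span_pureTensor.eq_zero_of_inner_left ℂ fun v hv => ?_
  induction hv using Submodule.span_induction with
  | mem _ h' => obtain ⟨p, rfl⟩ := h'; exact inner_eq_zero_symm.1 (h _ _)
  | zero => simp
  | add _ _ _ _ h₁ h₂ => rw [inner_add_right, h₁, h₂, add_zero]
  | smul c _ _ h₁ => rw [inner_smul_right, h₁, mul_zero]

/-- A countable dense subset of `L²(ℝ)` tests matrix coefficients that are jointly continuous. -/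
theorem forall_of_forall_denseSeq {p : L2R → L2R → Prop}
    (hp : IsClosed {z : L2R × L2R | p z.1 z.2})
    (h : ∀ i j, p (TopologicalSpace.denseSeq L2R i) (TopologicalSpace.denseSeq L2R j))
    (a b : L2R) : p a b := by
  have hd := (TopologicalSpace.denseRange_denseSeq L2R).prodMap
    (TopologicalSpace.denseRange_denseSeq L2R)
  exact hd.induction_on (p := fun z : L2R × L2R => p z.1 z.2) (a, b) hp fun z => h z.1 z.2

/-! ### Elementary elements of the Plancherel space -/

open scoped CompactlySupported

theorem memLp_smul_const {μ : Measure ℝ} [IsLocallyFiniteMeasure μ] {E : Type*}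
    [NormedAddCommGroup E] [NormedSpace ℂ E] (φ : C_c(ℝ, ℂ)) (w : E) :
    MemLp (fun lam => φ lam • w) 2 μ :=
  Continuous.memLp_of_hasCompactSupport (by fun_prop) (φ.hasCompactSupport.smul_right)

/-- The element `λ ↦ φ(λ) w` of the Plancherel space. -/
def plancherelElem (φ : C_c(ℝ, ℂ)) (w : L2Tensor) : PlancherelSpace :=
  (memLp_smul_const φ w).toLp _

theorem coeFn_plancherelElem (φ : C_c(ℝ, ℂ)) (w : L2Tensor) :
    plancherelElem φ w =ᵐ[plancherelMeasure] fun lam => φ lam • w :=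
  MemLp.coeFn_toLp _

/-- `plancherelElem` as a bilinear map. -/
def plancherelElemₗ : C_c(ℝ, ℂ) →ₗ[ℂ] L2Tensor →ₗ[ℂ] PlancherelSpace :=
  LinearMap.mk₂ ℂ plancherelElem
    (fun φ ψ w => by
      rw [plancherelElem, plancherelElem, plancherelElem, ← MemLp.toLp_add]
      exact MemLp.toLp_congr _ _ (Eventually.of_forall fun _ => add_smul _ _ _))
    (fun c φ w => by
      rw [plancherelElem, plancherelElem, ← MemLp.toLp_const_smul]
      exact MemLp.toLp_congr _ _ (Eventually.of_forall fun _ => smul_assoc c _ w))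
    (fun φ w w' => by
      rw [plancherelElem, plancherelElem, plancherelElem, ← MemLp.toLp_add]
      exact MemLp.toLp_congr _ _ (Eventually.of_forall fun _ => smul_add _ _ _))
    (fun c φ w => by
      rw [plancherelElem, plancherelElem, ← MemLp.toLp_const_smul]
      exact MemLp.toLp_congr _ _ (Eventually.of_forall fun lam => smul_comm (φ lam) c w))

theorem enorm_plancherelElem_sq (φ : C_c(ℝ, ℂ)) (w : L2Tensor) :
    ‖plancherelElem φ w‖ₑ ^ 2 = (∫⁻ lam, ENNReal.ofReal |lam| * ‖φ lam‖ₑ ^ 2) * ‖w‖ₑ ^ 2 := by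
  have hm : Measurable fun lam => ‖φ lam‖ₑ ^ 2 :=
    (φ.continuous.measurable.enorm).pow_const 2
  rw [Lp.enorm_def, eLpNorm_congr_ae (coeFn_plancherelElem φ w),
    ← lintegral_enorm_sq_eq_enorm_sq, ← lintegral_plancherelMeasure hm,
    ← lintegral_mul_const _ hm]
  simp only [enorm_smul, mul_pow]

theorem inner_plancherelElem (φ : C_c(ℝ, ℂ)) (w : L2Tensor) (Ψ : PlancherelSpace) :
    inner ℂ (plancherelElem φ w) Ψ =
      ∫ lam : ℝ, ((|lam| : ℝ) : ℂ) * (starRingEnd ℂ (φ lam) * inner ℂ w (Ψ lam)) := by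
  rw [L2.inner_def, ← integral_plancherelMeasure]
  refine integral_congr_ae ?_
  filter_upwards [coeFn_plancherelElem φ w] with lam h
  rw [h, inner_smul_left]

theorem memLp_inner_const (w : L2Tensor) (Ψ : PlancherelSpace) :
    MemLp (fun lam => inner ℂ w (Ψ lam)) 2 plancherelMeasure := (Lp.memLp Ψ).const_inner w

/-- Two functions that are locally integrable for the Plancherel measure and have the same
integrals against `C_c(ℝ, ℂ)` agree almost everywhere. -/
theorem ae_eq_of_forall_integral_mul_eq {F G : ℝ → ℂ} (hF : LocallyIntegrable F plancherelMeasure)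
    (hG : LocallyIntegrable G plancherelMeasure)
    (h : ∀ φ : C_c(ℝ, ℂ), ∫ lam : ℝ, ((|lam| : ℝ) : ℂ) * (starRingEnd ℂ (φ lam) * F lam) =
      ∫ lam : ℝ, ((|lam| : ℝ) : ℂ) * (starRingEnd ℂ (φ lam) * G lam)) :
    ∀ᵐ lam : ℝ, F lam = G lam := by
  rw [← ae_plancherelMeasure_iff]
  refine ae_eq_of_integral_contDiff_smul_eq hF hG fun g hg hc => ?_
  have := h ⟨⟨fun t => (g t : ℂ), by fun_prop (disch := exact hg.continuous)⟩,
    hc.comp_left (g := ((↑) : ℝ → ℂ)) rfl⟩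
  simp only [CompactlySupportedContinuousMap.coe_mk, ContinuousMap.coe_mk, Complex.conj_ofReal]
    at this
  rw [← integral_plancherelMeasure, ← integral_plancherelMeasure] at this
  simpa [Complex.real_smul] using this

/-- A vector orthogonal to all these elements has, for each a and b, vanishing coefficient against a
⊗ b off a null set depending on a and b. Countably many pairs make the null set uniform, and
continuity in (a, b) recovers all pairs. -/
theorem dense_span_plancherelElem :
    Dense (Submodule.span ℂ (Set.range fun i : C_c(ℝ, ℂ) × L2R × L2R =>
      plancherelElem i.1 (pureTensor i.2.1 i.2.2)) : Set PlancherelSpace) := by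
  rw [Submodule.dense_iff_topologicalClosure_eq_top, Submodule.topologicalClosure_eq_top_iff,
    Submodule.eq_bot_iff]
  intro Ψ hΨ
  rw [Submodule.mem_orthogonal] at hΨ
  have h (a b : L2R) : ∀ᵐ lam : ℝ, inner ℂ (pureTensor a b) (Ψ lam) = 0 := by
    refine ae_eq_of_forall_integral_mul_eq
      ((memLp_inner_const _ Ψ).locallyIntegrable one_le_two) (locallyIntegrable_const 0) fun φ => ?_
    rw [← inner_plancherelElem]
    simpa using hΨ _ (Submodule.subset_span ⟨(φ, a, b), rfl⟩)
  have h' : ∀ᵐ lam : ℝ, ∀ i j : ℕ, inner ℂ (pureTensor (TopologicalSpace.denseSeq L2R i)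
      (TopologicalSpace.denseSeq L2R j)) (Ψ lam) = 0 :=
    ae_all_iff.2 fun i => ae_all_iff.2 fun j => h _ _
  rw [Lp.eq_zero_iff_ae_eq_zero]
  refine ae_plancherelMeasure_iff.2 ?_
  filter_upwards [h'] with lam hlam
  exact eq_zero_of_inner_pureTensor_eq_zero (forall_of_forall_denseSeq
    (p := fun a b => inner ℂ (pureTensor a b) (Ψ lam) = 0)
    (isClosed_eq (continuous_pureTensor.inner continuous_const) continuous_const) hlam)

/-! ### Matrix elements of the Schrödinger representations -/

section MatrixElem

open FourierTransform
open scoped CompactlySupported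

theorem Heisenberg.measurable_x : Measurable Heisenberg.x :=
  measurable_fst.comp Heisenberg.measurableCoords.measurable
theorem Heisenberg.measurable_y : Measurable Heisenberg.y :=
  measurable_fst.comp (measurable_snd.comp Heisenberg.measurableCoords.measurable)
theorem Heisenberg.measurable_z : Measurable Heisenberg.z :=
  measurable_snd.comp (measurable_snd.comp Heisenberg.measurableCoords.measurable)

instance : SFinite (volume : Measure Heisenberg) :=
  inferInstanceAs (SFinite (Measure.map Heisenberg.measurableCoords.symm volume))

/-- The matrix element `⟨π_λ(n) u, v⟩`. -/
def matrixElem (lam : ℝ) (n : Heisenberg) (v u : L2R) : ℂ := inner ℂ v (schrodinger lam n u)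

/-- The function `t ↦ conj (v t) u(t - x)`. -/
def shiftProd (v u : L2R) (x t : ℝ) : ℂ := starRingEnd ℂ (v t) * u (t - x)

theorem stronglyMeasurable_shiftProd (v u : L2R) :
    StronglyMeasurable fun p : ℝ × ℝ => shiftProd v u p.1 p.2 := by
  refine StronglyMeasurable.mul ?_ ?_
  · exact RCLike.continuous_conj.comp_stronglyMeasurable
      ((Lp.stronglyMeasurable v).comp_measurable measurable_snd)
  · exact (Lp.stronglyMeasurable u).comp_measurable (measurable_snd.sub measurable_fst)

theorem integrable_shiftProd (v u : L2R) (x : ℝ) : Integrable (shiftProd v u x) :=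
  (Lp.memLp v).star.integrable_mul
    ((Lp.memLp u).comp_measurePreserving (measurePreserving_sub_right_real x))

theorem lintegral_enorm_L2R_sq (u : L2R) : ∫⁻ t, ‖u t‖ₑ ^ 2 = ‖u‖ₑ ^ 2 := by
  rw [lintegral_enorm_sq_eq_enorm_sq, Lp.enorm_def]

theorem lintegral_lintegral_enorm_shiftProd_sq (v u : L2R) :
    ∫⁻ x, ∫⁻ t, ‖shiftProd v u x t‖ₑ ^ 2 = ‖v‖ₑ ^ 2 * ‖u‖ₑ ^ 2 := by
  have hu : Measurable fun t => ‖u t‖ₑ ^ 2 :=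
    (Lp.stronglyMeasurable u).measurable.enorm.pow_const 2
  have hv : Measurable fun t => ‖v t‖ₑ ^ 2 :=
    (Lp.stronglyMeasurable v).measurable.enorm.pow_const 2
  rw [lintegral_lintegral_swap
    ((stronglyMeasurable_shiftProd v u).measurable.enorm.pow_const 2).aemeasurable]
  have h (t : ℝ) : ∫⁻ x, ‖shiftProd v u x t‖ₑ ^ 2 = ‖v t‖ₑ ^ 2 * ‖u‖ₑ ^ 2 := by
    have (x : ℝ) : ‖shiftProd v u x t‖ₑ ^ 2 = ‖v t‖ₑ ^ 2 * ‖u (t - x)‖ₑ ^ 2 := by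
      simp [shiftProd, enorm_mul, mul_pow]
    simp only [this]
    have hs : Measurable fun x => ‖u (t - x)‖ₑ ^ 2 :=
      hu.comp (measurable_const.sub measurable_id)
    rw [lintegral_const_mul _ hs,
      lintegral_sub_left_eq_self (fun s => ‖u s‖ₑ ^ 2) t, lintegral_enorm_L2R_sq]
  simp only [h]
  rw [lintegral_mul_const _ hv, lintegral_enorm_L2R_sq]

/-- For fixed x a product of two L² functions is only known to be integrable. Square integrability
holds for almost every x because the double integral of the square is finite by Tonelli. -/
theorem ae_memLp_shiftProd (v u : L2R) : ∀ᵐ x : ℝ, MemLp (shiftProd v u x) 2 volume := by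
  have hm : Measurable fun x => ∫⁻ t, ‖shiftProd v u x t‖ₑ ^ 2 :=
    ((stronglyMeasurable_shiftProd v u).measurable.enorm.pow_const 2).lintegral_prod_right'
  have h := ae_lt_top hm (by
    rw [lintegral_lintegral_enorm_shiftProd_sq]
    exact ENNReal.mul_ne_top (by simp) (by simp))
  filter_upwards [h] with x hx
  refine ⟨(integrable_shiftProd v u x).1, ?_⟩
  rw [lintegral_enorm_sq_eq_enorm_sq] at hx
  exact (ENNReal.pow_lt_top_iff.1 hx).resolve_right two_ne_zero

/-- In z the coefficient is a character of frequency λ, and in y it is a Fourier transform on the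
line dilated by λ. This reduces Plancherel on the group to Plancherel on the line. -/
theorem matrixElem_eq (lam : ℝ) (n : Heisenberg) (v u : L2R) :
    matrixElem lam n v u = Complex.exp (2 * Real.pi * Complex.I * lam * n.z) *
      𝓕 (shiftProd v u n.x) (lam * n.y) := by
  rw [matrixElem, L2.inner_def, Real.fourier_real_eq_integral_exp_smul, ← integral_const_mul]
  refine integral_congr_ae ?_
  filter_upwards [coeFn_schrodinger lam n u] with t ht
  rw [ht, schrodingerFun, shiftProd, RCLike.inner_apply, smul_eq_mul]
  have : (((-2 * Real.pi * t * (lam * n.y) : ℝ) : ℂ) * Complex.I) =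
      -2 * Real.pi * Complex.I * lam * n.y * t := by push_cast; ring
  rw [this]
  ring

theorem stronglyMeasurable_matrixElem (v u : L2R) :
    StronglyMeasurable fun p : ℝ × Heisenberg => matrixElem p.1 p.2 v u := by
  simp only [matrixElem_eq, Real.fourier_real_eq_integral_exp_smul, smul_eq_mul]
  have hx : Measurable fun p : (ℝ × Heisenberg) × ℝ => p.1.2.x :=
    Heisenberg.measurable_x.comp (measurable_snd.comp measurable_fst)
  have hy : Measurable fun p : (ℝ × Heisenberg) × ℝ => p.1.2.y :=
    Heisenberg.measurable_y.comp (measurable_snd.comp measurable_fst)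
  have hz : Measurable fun p : ℝ × Heisenberg => p.2.z :=
    Heisenberg.measurable_z.comp measurable_snd
  refine StronglyMeasurable.mul ?_ ?_
  · exact Measurable.stronglyMeasurable (by fun_prop)
  · refine StronglyMeasurable.integral_prod_right' (f := fun p : (ℝ × Heisenberg) × ℝ =>
      Complex.exp (((-2 * Real.pi * p.2 * (p.1.1 * p.1.2.y) : ℝ) : ℂ) * Complex.I) *
        shiftProd v u p.1.2.x p.2) ?_
    refine StronglyMeasurable.mul ?_ ?_
    · exact Measurable.stronglyMeasurable (by fun_prop)
    · exact (stronglyMeasurable_shiftProd v u).comp_measurable (hx.prodMk measurable_snd)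

theorem norm_matrixElem_le (lam : ℝ) (n : Heisenberg) (v u : L2R) :
    ‖matrixElem lam n v u‖ ≤ ‖v‖ * ‖u‖ := by
  refine (norm_inner_le_norm _ _).trans_eq ?_
  rw [LinearIsometry.norm_map]

/-! ### The inverse transform of an elementary element -/

/-- The function `n ↦ ∫ φ(λ) tr(π_λ(n)^* (v ⊗ b)) |λ| dλ`. -/
def inverseTransformFun (φ : C_c(ℝ, ℂ)) (v b : L2R) (n : Heisenberg) : ℂ :=
  ∫ lam : ℝ, ((|lam| : ℝ) : ℂ) * (φ lam * starRingEnd ℂ (matrixElem lam n v (conjL2R b)))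

theorem integrable_abs_mul (φ : C_c(ℝ, ℂ)) :
    Integrable fun lam : ℝ => ((|lam| : ℝ) : ℂ) * φ lam :=
  integrable_plancherelMeasure_iff.1 (φ.continuous.integrable_of_hasCompactSupport
    φ.hasCompactSupport)

theorem integrable_inverseTransform (φ : C_c(ℝ, ℂ)) (v b : L2R) (n : Heisenberg) :
    Integrable fun lam : ℝ => ((|lam| : ℝ) : ℂ) *
      (φ lam * starRingEnd ℂ (matrixElem lam n v (conjL2R b))) := by
  simp only [← mul_assoc]
  refine (integrable_abs_mul φ).mul_bdd (c := ‖v‖ * ‖conjL2R b‖) ?_ ?_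
  · exact (RCLike.continuous_conj.comp_stronglyMeasurable
      ((stronglyMeasurable_matrixElem v _).comp_measurable
        (measurable_id.prodMk measurable_const))).aestronglyMeasurable
  · exact Eventually.of_forall fun lam => by
      rw [RCLike.norm_conj]; exact norm_matrixElem_le _ _ _ _

theorem stronglyMeasurable_inverseTransformFun (φ : C_c(ℝ, ℂ)) (v b : L2R) :
    StronglyMeasurable (inverseTransformFun φ v b) := by
  refine StronglyMeasurable.integral_prod_right' (f := fun p : Heisenberg × ℝ =>
    ((|p.2| : ℝ) : ℂ) * (φ p.2 * starRingEnd ℂ (matrixElem p.2 p.1 v (conjL2R b)))) ?_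
  refine StronglyMeasurable.mul ?_ (StronglyMeasurable.mul ?_ ?_)
  · exact Measurable.stronglyMeasurable (by fun_prop)
  · exact (φ.continuous.stronglyMeasurable).comp_measurable measurable_snd
  · have h := (stronglyMeasurable_matrixElem v (conjL2R b)).comp_measurable
      (g := fun p : Heisenberg × ℝ => (p.2, p.1)) measurable_swap
    exact RCLike.continuous_conj.comp_stronglyMeasurable h

/-- The function whose Fourier transform at `z` is the value of `inverseTransformFun` at
`(x, y, z)`. -/
def partialInverse (φ : C_c(ℝ, ℂ)) (v u : L2R) (x y lam : ℝ) : ℂ :=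
  ((|lam| : ℝ) : ℂ) * φ lam * starRingEnd ℂ (𝓕 (shiftProd v u x) (lam * y))

theorem inverseTransformFun_eq (φ : C_c(ℝ, ℂ)) (v b : L2R) (x y z : ℝ) :
    inverseTransformFun φ v b ⟨x, y, z⟩ = 𝓕 (partialInverse φ v (conjL2R b) x y) z := by
  rw [inverseTransformFun, Real.fourier_real_eq_integral_exp_smul]
  refine integral_congr_ae (Eventually.of_forall fun lam => ?_)
  simp only [matrixElem_eq, partialInverse, map_mul, ← Complex.exp_conj, Complex.conj_I,
    Complex.conj_ofReal, smul_eq_mul, map_ofNat]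
  have : (((-2 * Real.pi * lam * z : ℝ) : ℂ) * Complex.I) =
      2 * Real.pi * -Complex.I * lam * z := by push_cast; ring
  rw [this]
  ring

theorem continuous_fourier_shiftProd (v u : L2R) (x : ℝ) : Continuous (𝓕 (shiftProd v u x)) :=
  VectorFourier.fourierIntegral_continuous Real.continuous_fourierChar (by fun_prop)
    (integrable_shiftProd v u x)

theorem continuous_partialInverse (φ : C_c(ℝ, ℂ)) (v u : L2R) (x y : ℝ) :
    Continuous (partialInverse φ v u x y) := by
  refine Continuous.mul (by fun_prop) ?_
  exact RCLike.continuous_conj.comp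
    ((continuous_fourier_shiftProd v u x).comp (by fun_prop))

theorem hasCompactSupport_partialInverse (φ : C_c(ℝ, ℂ)) (v u : L2R) (x y : ℝ) :
    HasCompactSupport (partialInverse φ v u x y) :=
  (φ.hasCompactSupport.mul_left).mul_right

theorem lintegral_heisenberg {g : Heisenberg → ENNReal} (hg : Measurable g) :
    ∫⁻ n, g n = ∫⁻ x, ∫⁻ y, ∫⁻ z, g ⟨x, y, z⟩ := by
  have hm : Measurable fun p => g (Heisenberg.measurableCoords.symm p) :=
    hg.comp Heisenberg.measurableCoords.symm.measurable
  rw [← Heisenberg.measurePreserving_coords_symm.lintegral_comp hg, Measure.volume_eq_prod,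
    lintegral_prod _ hm.aemeasurable]
  refine lintegral_congr fun x => ?_
  have hx : Measurable fun p : ℝ × ℝ => g (Heisenberg.measurableCoords.symm (x, p)) :=
    hm.comp (measurable_const.prodMk measurable_id)
  rw [Measure.volume_eq_prod, lintegral_prod _ hx.aemeasurable]
  rfl

/-- Plancherel in z produces |λ|² |φ(λ)|² times the squared transform of the shifted product at λy.
For λ ≠ 0 and almost every x, the dilated Plancherel theorem in y absorbs one factor |λ|; the other
remains as the Plancherel density. The x-integral then gives ‖v‖² ‖b‖². -/
theorem lintegral_enorm_inverseTransformFun_sq (φ : C_c(ℝ, ℂ)) (v b : L2R) :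
    ∫⁻ n, ‖inverseTransformFun φ v b n‖ₑ ^ 2 =
      (∫⁻ lam, ENNReal.ofReal |lam| * ‖φ lam‖ₑ ^ 2) * (‖v‖ₑ ^ 2 * ‖b‖ₑ ^ 2) := by
  set u := conjL2R b with hu
  have hub : ‖b‖ₑ = ‖u‖ₑ := by rw [hu, LinearIsometry.enorm_map]
  rw [lintegral_heisenberg
    ((stronglyMeasurable_inverseTransformFun φ v b).measurable.enorm.pow_const 2)]
  have hz (x y : ℝ) : ∫⁻ z, ‖inverseTransformFun φ v b ⟨x, y, z⟩‖ₑ ^ 2 =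
      ∫⁻ lam, ‖partialInverse φ v u x y lam‖ₑ ^ 2 := by
    simp only [inverseTransformFun_eq]
    exact lintegral_enorm_fourier_sq
      ((continuous_partialInverse φ v u x y).integrable_of_hasCompactSupport
        (hasCompactSupport_partialInverse φ v u x y))
      ((continuous_partialInverse φ v u x y).memLp_of_hasCompactSupport
        (hasCompactSupport_partialInverse φ v u x y))
  have hφ : Measurable fun lam : ℝ => ENNReal.ofReal |lam| * ‖φ lam‖ₑ ^ 2 :=
    measurable_ofReal_abs.mul (φ.continuous.measurable.enorm.pow_const 2)
  have hx : ∀ᵐ x : ℝ, ∫⁻ y, ∫⁻ lam, ‖partialInverse φ v u x y lam‖ₑ ^ 2 =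
      (∫⁻ lam, ENNReal.ofReal |lam| * ‖φ lam‖ₑ ^ 2) * ∫⁻ t, ‖shiftProd v u x t‖ₑ ^ 2 := by
    filter_upwards [ae_memLp_shiftProd v u] with x hx
    have hF : Measurable (𝓕 (shiftProd v u x)) :=
      (continuous_fourier_shiftProd v u x).measurable
    rw [lintegral_lintegral_swap, ← lintegral_mul_const _ hφ]
    · refine lintegral_congr_ae ?_
      have h0 : ∀ᵐ lam : ℝ, lam ≠ 0 := by simp [ae_iff, measure_singleton]
      filter_upwards [h0] with lam h0
      rw [← lintegral_enorm_fourier_mul_sq (integrable_shiftProd v u x) hx h0]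
      have (y : ℝ) : ‖partialInverse φ v u x y lam‖ₑ ^ 2 =
          (ENNReal.ofReal |lam| ^ 2 * ‖φ lam‖ₑ ^ 2) * ‖𝓕 (shiftProd v u x) (lam * y)‖ₑ ^ 2 := by
        have hab : ‖((|lam| : ℝ) : ℂ)‖ₑ = ENNReal.ofReal |lam| := by
          rw [← ofReal_norm, Complex.norm_real, Real.norm_eq_abs, abs_abs]
        simp only [partialInverse, enorm_mul, hab, mul_pow, RCLike.enorm_conj]
      simp only [this]
      have hs : Measurable fun y => ‖𝓕 (shiftProd v u x) (lam * y)‖ₑ ^ 2 :=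
        (hF.comp (measurable_const_mul lam)).enorm.pow_const 2
      rw [lintegral_const_mul _ hs]
      ring
    · refine Measurable.aemeasurable (Measurable.pow_const (Measurable.enorm ?_) 2)
      refine Measurable.mul (by fun_prop) ?_
      exact RCLike.continuous_conj.measurable.comp
        (hF.comp (measurable_snd.mul measurable_fst))
  simp only [hz]
  rw [lintegral_congr_ae hx, lintegral_const_mul, lintegral_lintegral_enorm_shiftProd_sq, hub]
  exact ((stronglyMeasurable_shiftProd v u).measurable.enorm.pow_const 2).lintegral_prod_right'

theorem lintegral_abs_mul_enorm_sq_lt_top (φ : C_c(ℝ, ℂ)) :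
    ∫⁻ lam, ENNReal.ofReal |lam| * ‖φ lam‖ₑ ^ 2 < ⊤ := by
  have hm : Measurable fun lam => ‖φ lam‖ₑ ^ 2 := φ.continuous.measurable.enorm.pow_const 2
  rw [← lintegral_plancherelMeasure hm, lintegral_enorm_sq_eq_enorm_sq]
  exact ENNReal.pow_lt_top (φ.continuous.memLp_of_hasCompactSupport φ.hasCompactSupport).2

theorem memLp_inverseTransformFun (φ : C_c(ℝ, ℂ)) (v b : L2R) :
    MemLp (inverseTransformFun φ v b) 2 volume := by
  refine ⟨(stronglyMeasurable_inverseTransformFun φ v b).aestronglyMeasurable, ?_⟩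
  have h : eLpNorm (inverseTransformFun φ v b) 2 volume ^ 2 < ⊤ := by
    rw [← lintegral_enorm_sq_eq_enorm_sq, lintegral_enorm_inverseTransformFun_sq]
    exact ENNReal.mul_lt_top (lintegral_abs_mul_enorm_sq_lt_top φ)
      (ENNReal.mul_lt_top (by simp) (by simp))
  exact (ENNReal.pow_lt_top_iff.1 h).resolve_right two_ne_zero

/-- The inverse transform of `λ ↦ φ(λ) v ⊗ b` as an element of `L²(ℍ)`. -/
def inverseTransform (φ : C_c(ℝ, ℂ)) (v b : L2R) : Heisenberg.L2 :=
  (memLp_inverseTransformFun φ v b).toLp _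

theorem enorm_inverseTransform_sq (φ : C_c(ℝ, ℂ)) (v b : L2R) :
    ‖inverseTransform φ v b‖ₑ ^ 2 = ‖plancherelElem φ (pureTensor v b)‖ₑ ^ 2 := by
  rw [enorm_plancherelElem_sq, inverseTransform, Lp.enorm_toLp, ← lintegral_enorm_sq_eq_enorm_sq,
    lintegral_enorm_inverseTransformFun_sq, ← ofReal_norm (pureTensor v b), norm_pureTensor,
    ENNReal.ofReal_mul (norm_nonneg _), ofReal_norm, ofReal_norm, mul_pow]

theorem norm_inverseTransform (φ : C_c(ℝ, ℂ)) (v b : L2R) :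
    ‖inverseTransform φ v b‖ = ‖plancherelElem φ (pureTensor v b)‖ := by
  have h := (ENNReal.pow_right_strictMono two_ne_zero).injective (enorm_inverseTransform_sq φ v b)
  simpa using congrArg ENNReal.toReal h

/-- `inverseTransform` as a trilinear map. -/
def inverseTransformₗ : C_c(ℝ, ℂ) →ₗ[ℂ] L2R →ₗ[ℂ] L2R →ₗ[ℂ] Heisenberg.L2 where
  toFun φ := LinearMap.mk₂ ℂ (inverseTransform φ)
    (fun v v' b => by
      rw [inverseTransform, inverseTransform, inverseTransform, ← MemLp.toLp_add]
      refine MemLp.toLp_congr _ _ (Eventually.of_forall fun n => ?_)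
      rw [Pi.add_apply, inverseTransformFun, inverseTransformFun, inverseTransformFun,
        ← integral_add (integrable_inverseTransform φ v b n) (integrable_inverseTransform φ v' b n)]
      simp only [matrixElem, inner_add_left, map_add, mul_add])
    (fun c v b => by
      rw [inverseTransform, inverseTransform, ← MemLp.toLp_const_smul]
      refine MemLp.toLp_congr _ _ (Eventually.of_forall fun n => ?_)
      rw [Pi.smul_apply, inverseTransformFun, inverseTransformFun, ← integral_smul]
      refine integral_congr_ae (Eventually.of_forall fun lam => ?_)
      simp only [matrixElem, inner_smul_left, map_mul, Complex.conj_conj, smul_eq_mul]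
      ring)
    (fun v b b' => by
      rw [inverseTransform, inverseTransform, inverseTransform, ← MemLp.toLp_add]
      refine MemLp.toLp_congr _ _ (Eventually.of_forall fun n => ?_)
      rw [Pi.add_apply, inverseTransformFun, inverseTransformFun, inverseTransformFun,
        ← integral_add (integrable_inverseTransform φ v b n) (integrable_inverseTransform φ v b' n)]
      simp only [matrixElem, inner_add_right, map_add, mul_add])
    (fun c v b => by
      rw [inverseTransform, inverseTransform, ← MemLp.toLp_const_smul]
      refine MemLp.toLp_congr _ _ (Eventually.of_forall fun n => ?_)
      rw [Pi.smul_apply, inverseTransformFun, inverseTransformFun, ← integral_smul]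
      refine integral_congr_ae (Eventually.of_forall fun lam => ?_)
      simp only [matrixElem, inner_smul_right, map_mul, map_smulₛₗ, RingHom.id_apply,
        Complex.conj_conj, smul_eq_mul]
      ring)
  map_add' φ ψ := by
    ext1 v
    ext1 b
    change inverseTransform _ _ _ = inverseTransform _ _ _ + inverseTransform _ _ _
    rw [inverseTransform, inverseTransform, inverseTransform, ← MemLp.toLp_add]
    refine MemLp.toLp_congr _ _ (Eventually.of_forall fun n => ?_)
    rw [Pi.add_apply, inverseTransformFun, inverseTransformFun, inverseTransformFun,
      ← integral_add (integrable_inverseTransform φ v b n) (integrable_inverseTransform ψ v b n)]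
    simp only [CompactlySupportedContinuousMap.add_apply, add_mul, mul_add]
  map_smul' c φ := by
    ext1 v
    ext1 b
    change inverseTransform _ _ _ = c • inverseTransform _ _ _
    rw [inverseTransform, inverseTransform, ← MemLp.toLp_const_smul]
    refine MemLp.toLp_congr _ _ (Eventually.of_forall fun n => ?_)
    rw [Pi.smul_apply, inverseTransformFun, inverseTransformFun, ← integral_smul]
    refine integral_congr_ae (Eventually.of_forall fun lam => ?_)
    simp only [CompactlySupportedContinuousMap.smul_apply, smul_eq_mul]
    ring

/-- The map `(φ, v, b) ↦ (λ ↦ φ(λ) v ⊗ b)` into the Plancherel space as a trilinear map. -/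
def plancherelTensorₗ : C_c(ℝ, ℂ) →ₗ[ℂ] L2R →ₗ[ℂ] L2R →ₗ[ℂ] PlancherelSpace where
  toFun φ := pureTensorₗ.compr₂ (plancherelElemₗ φ)
  map_add' φ ψ := by
    ext1 v
    ext1 b
    simp
  map_smul' c φ := by
    ext1 v
    ext1 b
    simp

/-- Equality of norms on elementary elements does not by itself control sums. Trilinearity and
polarization upgrade it to equality of Gram matrices, which yields an isometry on the dense span and
hence everywhere. -/
theorem exists_inverse_plancherel : ∃ Q : PlancherelSpace →ₗᵢ[ℂ] Heisenberg.L2,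
    ∀ (φ : C_c(ℝ, ℂ)) (v b : L2R),
      Q (plancherelElem φ (pureTensor v b)) = inverseTransform φ v b := by
  obtain ⟨Q, hQ⟩ := exists_linearIsometry_of_inner_eq
    (q := fun i : C_c(ℝ, ℂ) × L2R × L2R => inverseTransform i.1 i.2.1 i.2.2)
    dense_span_plancherelElem fun i j =>
      inner_eq_inner_of_norm_eq₃ (f := inverseTransformₗ) (g := plancherelTensorₗ)
        (fun φ v b => norm_inverseTransform φ v b) i.1 j.1 i.2.1 j.2.1 i.2.2 j.2.2
  exact ⟨Q, fun φ v b => hQ (φ, v, b)⟩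

end MatrixElem

open scoped CompactlySupported

/-! ### The Plancherel transform as a coisometry -/

/-- The isometry that extends `inverseTransform`. -/
def inversePlancherel : PlancherelSpace →ₗᵢ[ℂ] Heisenberg.L2 := exists_inverse_plancherel.choose

theorem inversePlancherel_plancherelElem (φ : C_c(ℝ, ℂ)) (v b : L2R) :
    inversePlancherel (plancherelElem φ (pureTensor v b)) = inverseTransform φ v b :=
  exists_inverse_plancherel.choose_spec φ v b

/-- The adjoint of `inversePlancherel`. -/
def plancherelCLM : Heisenberg.L2 →L[ℂ] PlancherelSpace :=
  ContinuousLinearMap.adjoint inversePlancherel.toContinuousLinearMap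

theorem inner_plancherelCLM (Φ : PlancherelSpace) (f : Heisenberg.L2) :
    inner ℂ Φ (plancherelCLM f) = inner ℂ (inversePlancherel Φ) f :=
  ContinuousLinearMap.adjoint_inner_right _ _ _

theorem plancherelCLM_inversePlancherel (Φ : PlancherelSpace) :
    plancherelCLM (inversePlancherel Φ) = Φ :=
  ext_inner_left ℂ fun Ψ => by rw [inner_plancherelCLM, LinearIsometry.inner_map_map]

theorem conjL2R_conjL2R (u : L2R) : conjL2R (conjL2R u) = u := star_star u

theorem inner_conjL2R (u v : L2R) : inner ℂ (conjL2R u) (conjL2R v) = inner ℂ v u := by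
  rw [L2.inner_def, L2.inner_def]
  refine integral_congr_ae ?_
  filter_upwards [Lp.coeFn_star u, Lp.coeFn_star v] with t hu hv
  change inner ℂ ((star u : L2R) t) ((star v : L2R) t) = _
  rw [hu, hv]
  simp [mul_comm]

theorem inner_pureTensor_eq_matrixCoeff (v b : L2R) (T : L2Tensor) :
    inner ℂ (pureTensor v b) T = matrixCoeff T (conjL2R b) v := by
  rw [matrixCoeff, conjL2R_conjL2R]

theorem ext_matrixCoeff {S T : L2Tensor} (h : ∀ u v, matrixCoeff S u v = matrixCoeff T u v) :
    S = T := by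
  refine sub_eq_zero.1 (eq_zero_of_inner_pureTensor_eq_zero fun a b => ?_)
  rw [inner_sub_right, inner_pureTensor_eq_matrixCoeff, inner_pureTensor_eq_matrixCoeff, h,
    sub_self]

/-- The matrix coefficients of `∫ g(n) π_λ(n) dn`. -/
def fourierCoeffFun (g : Heisenberg.L2) (v u : L2R) (lam : ℝ) : ℂ :=
  ∫ n, g n * matrixElem lam n v u

theorem integrable_mul_matrixElem {g : Heisenberg.L2} (hg : Integrable g) (v u : L2R) (lam : ℝ) :
    Integrable fun n => g n * matrixElem lam n v u := by
  refine hg.mul_bdd (c := ‖v‖ * ‖u‖) ?_ (Eventually.of_forall fun n => norm_matrixElem_le _ _ _ _)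
  exact ((stronglyMeasurable_matrixElem v u).comp_measurable
    measurable_prodMk_left).aestronglyMeasurable

theorem norm_fourierCoeffFun_le {g : Heisenberg.L2} (hg : Integrable g) (v u : L2R) (lam : ℝ) :
    ‖fourierCoeffFun g v u lam‖ ≤ (∫ n, ‖g n‖) * (‖v‖ * ‖u‖) := by
  rw [fourierCoeffFun, ← integral_mul_const]
  refine norm_integral_le_of_norm_le (hg.norm.mul_const _) (Eventually.of_forall fun n => ?_)
  rw [norm_mul]
  exact mul_le_mul_of_nonneg_left (norm_matrixElem_le _ _ _ _) (norm_nonneg _)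

theorem stronglyMeasurable_fourierCoeffFun (g : Heisenberg.L2) (v u : L2R) :
    StronglyMeasurable (fourierCoeffFun g v u) := by
  refine StronglyMeasurable.integral_prod_right'
    (f := fun p : ℝ × Heisenberg => g p.2 * matrixElem p.1 p.2 v u) ?_
  exact ((Lp.stronglyMeasurable g).comp_measurable measurable_snd).mul
    (stronglyMeasurable_matrixElem v u)

theorem locallyIntegrable_fourierCoeffFun {g : Heisenberg.L2} (hg : Integrable g) (v u : L2R) :
    LocallyIntegrable (fourierCoeffFun g v u) plancherelMeasure :=
  (locallyIntegrable_const ((∫ n, ‖g n‖) * (‖v‖ * ‖u‖))).mono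
    (stronglyMeasurable_fourierCoeffFun g v u).aestronglyMeasurable
    (Eventually.of_forall fun lam => (norm_fourierCoeffFun_le hg v u lam).trans
      (le_abs_self _))

/-- Fubini applies because g is integrable on the group, |λ|φ(λ) is integrable on the line and the
matrix elements are bounded. It is the link between the adjoint of `inversePlancherel` and the group
Fourier transform. -/
theorem inner_inverseTransform {g : Heisenberg.L2} (hg : Integrable g) (φ : C_c(ℝ, ℂ))
    (v b : L2R) :
    inner ℂ (inverseTransform φ v b) g = ∫ lam : ℝ, ((|lam| : ℝ) : ℂ) *
      (starRingEnd ℂ (φ lam) * fourierCoeffFun g v (conjL2R b) lam) := by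
  set u := conjL2R b
  have hF : Integrable (Function.uncurry fun (n : Heisenberg) (lam : ℝ) =>
      (g n * starRingEnd ℂ (((|lam| : ℝ) : ℂ) * φ lam)) * matrixElem lam n v u)
      (volume.prod volume) := by
    have h₁ : Integrable (fun p : Heisenberg × ℝ =>
        g p.1 * starRingEnd ℂ (((|p.2| : ℝ) : ℂ) * φ p.2)) (volume.prod volume) :=
      hg.mul_prod ((ContinuousLinearEquiv.integrable_comp_iff Complex.conjCLE).2
        (integrable_abs_mul φ))
    refine h₁.mul_bdd (c := ‖v‖ * ‖u‖) ?_
      (Eventually.of_forall fun p => norm_matrixElem_le _ _ _ _)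
    exact ((stronglyMeasurable_matrixElem v u).comp_measurable
      (g := fun p : Heisenberg × ℝ => (p.2, p.1)) measurable_swap).aestronglyMeasurable
  calc inner ℂ (inverseTransform φ v b) g
      = ∫ n, ∫ lam : ℝ, (g n * starRingEnd ℂ (((|lam| : ℝ) : ℂ) * φ lam)) *
          matrixElem lam n v u := by
        rw [L2.inner_def]
        refine integral_congr_ae ?_
        filter_upwards [(memLp_inverseTransformFun φ v b).coeFn_toLp] with n hn
        rw [inverseTransform, hn, RCLike.inner_apply, inverseTransformFun, ← integral_conj,
          ← integral_const_mul]
        refine integral_congr_ae (Eventually.of_forall fun lam => ?_)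
        simp only [map_mul, Complex.conj_conj, Complex.conj_ofReal]
        ring
    _ = ∫ lam : ℝ, ∫ n, (g n * starRingEnd ℂ (((|lam| : ℝ) : ℂ) * φ lam)) *
          matrixElem lam n v u := integral_integral_swap hF
    _ = _ := by
        refine integral_congr_ae (Eventually.of_forall fun lam => ?_)
        simp only [fourierCoeffFun]
        rw [← integral_const_mul, ← integral_const_mul]
        refine integral_congr_ae (Eventually.of_forall fun n => ?_)
        simp only [map_mul, Complex.conj_ofReal]
        ring

theorem IsGroupFourierTransform.eq_plancherelCLM {g : Heisenberg.L2} {Ψ : PlancherelSpace}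
    (h : IsGroupFourierTransform g Ψ) : Ψ = plancherelCLM g := by
  refine dense_span_plancherelElem.eq_of_inner_right ℂ fun x hx => ?_
  induction hx using Submodule.span_induction with
  | mem _ h' =>
    obtain ⟨⟨φ, v, b⟩, rfl⟩ := h'
    dsimp only
    rw [inner_plancherelCLM, inversePlancherel_plancherelElem, inner_inverseTransform h.1,
      inner_plancherelElem]
    refine integral_congr_ae ?_
    filter_upwards [h.2] with lam hlam
    rw [inner_pureTensor_eq_matrixCoeff, hlam]
    rfl
  | zero => simp
  | add _ _ _ _ h₁ h₂ => rw [inner_add_left, inner_add_left, h₁, h₂]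
  | smul c _ _ h₁ => rw [inner_smul_left, inner_smul_left, h₁]

/-- For each pair of vectors the coefficients agree off a null set, since they agree weakly against
C_c. A single null set for all pairs comes from a dense sequence and the joint continuity of both
sides. -/
theorem isGroupFourierTransform_plancherelCLM {g : Heisenberg.L2} (hg : Integrable g) :
    IsGroupFourierTransform g (plancherelCLM g) := by
  refine ⟨hg, ?_⟩
  have h (v b : L2R) : ∀ᵐ lam : ℝ, inner ℂ (pureTensor v b) (plancherelCLM g lam) =
      fourierCoeffFun g v (conjL2R b) lam := by
    refine ae_eq_of_forall_integral_mul_eq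
      ((memLp_inner_const _ _).locallyIntegrable one_le_two)
      (locallyIntegrable_fourierCoeffFun hg _ _) fun φ => ?_
    rw [← inner_inverseTransform hg, ← inner_plancherelElem, inner_plancherelCLM,
      inversePlancherel_plancherelElem]
  have h' : ∀ᵐ lam : ℝ, ∀ i j : ℕ, inner ℂ (pureTensor (TopologicalSpace.denseSeq L2R i)
      (TopologicalSpace.denseSeq L2R j)) (plancherelCLM g lam) =
      fourierCoeffFun g (TopologicalSpace.denseSeq L2R i)
        (conjL2R (TopologicalSpace.denseSeq L2R j)) lam :=
    ae_all_iff.2 fun i => ae_all_iff.2 fun j => h _ _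
  filter_upwards [h'] with lam hlam u v
  have hc : Continuous fun p : L2R × L2R => fourierCoeffFun g p.1 (conjL2R p.2) lam := by
    refine continuous_iff_continuousAt.2 fun p₀ => ?_
    -- Dominated convergence: the summand 1 in the bound gives room for p to vary in a neighbourhood
    -- of p₀.
    refine continuousAt_of_dominated
      (bound := fun n => ‖g n‖ * (‖p₀.1‖ * ‖conjL2R p₀.2‖ + 1))
      (Eventually.of_forall fun p => (integrable_mul_matrixElem hg _ _ lam).1) ?_
      (hg.norm.mul_const _) (Eventually.of_forall fun n => ?_)
    · have hb : Continuous fun p : L2R × L2R => ‖p.1‖ * ‖conjL2R p.2‖ :=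
        continuous_fst.norm.mul (conjL2R.continuous.comp continuous_snd).norm
      filter_upwards [hb.continuousAt.eventually_lt_const (lt_add_one _)] with p hp
      refine Eventually.of_forall fun n => ?_
      rw [norm_mul]
      exact mul_le_mul_of_nonneg_left ((norm_matrixElem_le _ _ _ _).trans hp.le) (norm_nonneg _)
    · exact (continuous_const.mul (continuous_fst.inner ((schrodinger lam n).continuous.comp
        (conjL2R.continuous.comp continuous_snd)))).continuousAt
  have key := forall_of_forall_denseSeq (p := fun a b => inner ℂ (pureTensor a b)
    (plancherelCLM g lam) = fourierCoeffFun g a (conjL2R b) lam)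
    (isClosed_eq (continuous_pureTensor.inner continuous_const) hc) hlam v (conjL2R u)
  rw [conjL2R_conjL2R, inner_pureTensor_eq_matrixCoeff, conjL2R_conjL2R] at key
  exact key

theorem dense_integrable : Dense {g : Heisenberg.L2 | Integrable g} := by
  have hd : DenseRange ((↑) : Lp.simpleFunc ℂ 2 (volume : Measure Heisenberg) → Heisenberg.L2) :=
    Lp.simpleFunc.denseRange ENNReal.ofNat_ne_top
  refine hd.mono ?_
  rintro _ ⟨s, rfl⟩
  have h : Integrable (Lp.simpleFunc.toSimpleFunc s) :=
    (SimpleFunc.memLp_iff_integrable two_ne_zero ENNReal.ofNat_ne_top).1 (Lp.simpleFunc.memLp s)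
  exact h.congr (Lp.simpleFunc.toSimpleFunc_eq_toFun s)

/-- The graph of a continuous map is closed and contains all Fourier transform pairs; density of the
integrable functions makes it exactly their closure. So the choice in `plancherel` is forced. -/
theorem isPlancherelTransform_iff {f : Heisenberg.L2} {Φ : PlancherelSpace} :
    IsPlancherelTransform f Φ ↔ Φ = plancherelCLM f := by
  constructor
  · intro h
    have hc : IsClosed {p : Heisenberg.L2 × PlancherelSpace | p.2 = plancherelCLM p.1} :=
      isClosed_eq continuous_snd (plancherelCLM.continuous.comp continuous_fst)
    exact closure_minimal (fun p hp => IsGroupFourierTransform.eq_plancherelCLM hp) hc h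
  · rintro rfl
    have hc : Continuous fun g : Heisenberg.L2 => (g, plancherelCLM g) :=
      continuous_id.prodMk plancherelCLM.continuous
    refine closure_mono ?_ (image_closure_subset_closure_image hc ⟨f, dense_integrable f, rfl⟩)
    rintro _ ⟨g, hg, rfl⟩
    exact isGroupFourierTransform_plancherelCLM hg

theorem plancherel_eq (f : Heisenberg.L2) : plancherel f = plancherelCLM f := by
  have h : ∃ Φ, IsPlancherelTransform f Φ := ⟨_, isPlancherelTransform_iff.2 rfl⟩
  rw [plancherel, dif_pos h]
  exact isPlancherelTransform_iff.1 h.choose_spec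

/-! ### Equivariance -/

theorem schrodinger_mul (lam : ℝ) (g h : Heisenberg) (u : L2R) :
    schrodinger lam (g * h) u = schrodinger lam g (schrodinger lam h u) := by
  apply Lp.ext
  have h' := (measurePreserving_sub_right_real g.x).quasiMeasurePreserving.ae
    (coeFn_schrodinger lam h u)
  filter_upwards [coeFn_schrodinger lam (g * h) u,
    coeFn_schrodinger lam g (schrodinger lam h u), h'] with t h₁ h₂ h₃
  rw [h₁, h₂, schrodingerFun, schrodingerFun, h₃, schrodingerFun]
  simp only [Heisenberg.mul_def, ← mul_assoc, ← Complex.exp_add]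
  rw [sub_sub]
  congr 2
  push_cast
  ring

theorem schrodinger_one (lam : ℝ) (u : L2R) : schrodinger lam 1 u = u := by
  apply Lp.ext
  filter_upwards [coeFn_schrodinger lam 1 u] with t h
  rw [h, schrodingerFun]
  simp [Heisenberg.one_def]

theorem inner_schrodinger (lam : ℝ) (g : Heisenberg) (v u : L2R) :
    inner ℂ v (schrodinger lam g u) = inner ℂ (schrodinger lam g⁻¹ v) u := by
  rw [← LinearIsometry.inner_map_map (schrodinger lam g) (schrodinger lam g⁻¹ v),
    ← schrodinger_mul, mul_inv_cancel, schrodinger_one]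

theorem inner_contragredient (lam : ℝ) (g : Heisenberg) (u b : L2R) :
    inner ℂ (conjL2R u) (contragredient lam g b) =
      inner ℂ (conjL2R (schrodinger lam g⁻¹ u)) b := by
  have : contragredient lam g b = conjL2R (ContinuousLinearMap.adjoint
    (schrodinger lam g⁻¹).toContinuousLinearMap (conjL2R b)) := rfl
  rw [this, inner_conjL2R, ContinuousLinearMap.adjoint_inner_left]
  change inner ℂ (conjL2R b) (schrodinger lam g⁻¹ u) = _
  rw [← inner_conjL2R, conjL2R_conjL2R]

theorem tensorRep_pureTensor (lam : ℝ) (κ η : Heisenberg) (a b : L2R) :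
    tensorRep lam κ η (pureTensor a b) =
      pureTensor (schrodinger lam κ a) (contragredient lam η b) :=
  ContinuousLinearMap.completion_apply_coe _ _

/-- In operator terms, T ↦ π_λ(κ) T π_λ(η)⁻¹. Both sides are linear and continuous in T, so
elementary tensors suffice. -/
theorem matrixCoeff_tensorRep (lam : ℝ) (κ η : Heisenberg) (T : L2Tensor) (u v : L2R) :
    matrixCoeff (tensorRep lam κ η T) u v =
      matrixCoeff T (schrodinger lam η⁻¹ u) (schrodinger lam κ⁻¹ v) := by
  have hcl : IsClosed {T : L2Tensor | matrixCoeff (tensorRep lam κ η T) u v =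
      matrixCoeff T (schrodinger lam η⁻¹ u) (schrodinger lam κ⁻¹ v)} :=
    isClosed_eq (continuous_const.inner (tensorRep lam κ η).continuous)
      (continuous_const.inner continuous_id)
  refine hcl.closure_subset_iff.2 (fun x hx => ?_) (dense_span_pureTensor T)
  induction hx using Submodule.span_induction with
  | mem _ h' =>
    obtain ⟨⟨a, b⟩, rfl⟩ := h'
    change inner ℂ (pureTensor v (conjL2R u)) (tensorRep lam κ η (pureTensor a b)) =
      inner ℂ (pureTensor _ (conjL2R _)) (pureTensor a b)
    rw [tensorRep_pureTensor, inner_pureTensor, inner_pureTensor, inner_schrodinger,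
      inner_contragredient]
  | zero => simp [matrixCoeff]
  | add _ _ _ _ h₁ h₂ =>
    simp only [Set.mem_ofPred_eq, matrixCoeff, map_add, inner_add_right] at h₁ h₂ ⊢
    rw [h₁, h₂]
  | smul c _ _ h₁ =>
    simp only [Set.mem_ofPred_eq, matrixCoeff, map_smul, inner_smul_right] at h₁ ⊢
    rw [h₁]

/-- The measure-preserving substitution replacing κ⁻¹nη by n in ∫ g(κ⁻¹nη) π_λ(n) dn pulls out
π_λ(κ) on the left and π_λ(η)⁻¹ on the right. -/
theorem plancherelCLM_biregular_of_integrable (κ η : Heisenberg) {g : Heisenberg.L2}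
    (hg : Integrable g) :
    ∀ᵐ lam : ℝ, plancherelCLM (Heisenberg.biregular κ η g) lam =
      tensorRep lam κ η (plancherelCLM g lam) := by
  have mp := Heisenberg.measurePreserving_inv_mul_mul κ η
  have hco : Heisenberg.biregular κ η g =ᵐ[volume] fun n => g (κ⁻¹ * n * η) :=
    Lp.coeFn_compMeasurePreserving g mp
  have hτ : Integrable (Heisenberg.biregular κ η g) :=
    (mp.integrable_comp_of_integrable hg).congr hco.symm
  filter_upwards [(isGroupFourierTransform_plancherelCLM hg).2,
    (isGroupFourierTransform_plancherelCLM hτ).2] with lam h₁ h₂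
  refine ext_matrixCoeff fun u v => ?_
  have hmap {F : Heisenberg → ℂ} (hF : AEStronglyMeasurable F volume) :
      ∫ n, F (κ⁻¹ * n * η) = ∫ n, F n := by
    rw [← integral_map mp.aemeasurable (by rwa [mp.map_eq]), mp.map_eq]
  rw [matrixCoeff_tensorRep, h₁, h₂]
  refine Eq.trans ?_ (hmap (integrable_mul_matrixElem hg (schrodinger lam κ⁻¹ v)
    (schrodinger lam η⁻¹ u) lam).1)
  refine integral_congr_ae ?_
  filter_upwards [hco] with n hn
  rw [hn, ← schrodinger_mul, ← inner_schrodinger, ← schrodinger_mul]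
  congr 4
  group

theorem exists_seq_tendsto_ae_of_tendsto {ι : Type*} [MeasurableSpace ι] {μ : Measure ι}
    {E : Type*} [NormedAddCommGroup E] {F : ℕ → Lp E 2 μ} {G : Lp E 2 μ}
    (h : Tendsto F atTop (𝓝 G)) :
    ∃ ns : ℕ → ℕ, StrictMono ns ∧ ∀ᵐ x ∂μ, Tendsto (fun i => F (ns i) x) atTop (𝓝 (G x)) :=
  (tendstoInMeasure_of_tendsto_Lp h).exists_seq_tendsto_ae

/-- The Plancherel transform intertwines the biregular representation with the field of
representations `π_λ ⊗ π̄_λ`. -/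
theorem plancherelCLM_biregular (κ η : Heisenberg) (f : Heisenberg.L2) :
    ∀ᵐ lam : ℝ, plancherelCLM (Heisenberg.biregular κ η f) lam =
      tensorRep lam κ η (plancherelCLM f lam) := by
  obtain ⟨s, hs, hsf⟩ := mem_closure_iff_seq_limit.1 (dense_integrable f)
  have h₁ : Tendsto (fun n => plancherelCLM (s n)) atTop (𝓝 (plancherelCLM f)) :=
    (plancherelCLM.continuous.tendsto f).comp hsf
  have h₂ : Tendsto (fun n => plancherelCLM (Heisenberg.biregular κ η (s n))) atTop
      (𝓝 (plancherelCLM (Heisenberg.biregular κ η f))) :=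
    ((plancherelCLM.continuous.comp (Heisenberg.biregular κ η).continuous).tendsto f).comp hsf
  obtain ⟨n₁, hn₁, ha₁⟩ := exists_seq_tendsto_ae_of_tendsto h₁
  -- L² convergence gives pointwise convergence only along a subsequence; the second is extracted
  -- from the first so that both limits hold along it.
  obtain ⟨n₂, hn₂, ha₂⟩ := exists_seq_tendsto_ae_of_tendsto (h₂.comp hn₁.tendsto_atTop)
  have hall : ∀ᵐ lam : ℝ, ∀ n, plancherelCLM (Heisenberg.biregular κ η (s n)) lam =
      tensorRep lam κ η (plancherelCLM (s n) lam) :=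
    ae_all_iff.2 fun n => plancherelCLM_biregular_of_integrable κ η (hs n)
  filter_upwards [ae_plancherelMeasure_iff.1 ha₁, ae_plancherelMeasure_iff.1 ha₂, hall]
    with lam l₁ l₂ l₃
  refine tendsto_nhds_unique l₂ ?_
  simp only [Function.comp_apply, l₃]
  exact ((tensorRep lam κ η).continuous.tendsto _).comp (l₁.comp hn₂.tendsto_atTop)

/-! ### Fourier series on a set congruent to the unit interval -/

theorem ae_forall_add_intCast_notMem {N : Set ℝ} (hN : volume N = 0) :
    ∀ᵐ t : ℝ, ∀ m : ℤ, t + m ∉ N := by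
  refine ae_all_iff.2 fun m => ?_
  exact (measurePreserving_add_right (volume : Measure ℝ) (m : ℝ)).quasiMeasurePreserving.ae
    (measure_eq_zero_iff_ae_notMem.1 hN)

/-- Neither ρ nor k is assumed measurable. This is harmless: ρ moves points by integers, and the
countably many integer translates of a null set are null. Injectivity of ρ gives at most one
representative per class, surjectivity gives at least one for almost every class. -/
theorem exists_measurableSet_of_translationCongruent {S : Set ℝ} (hS : NullMeasurableSet S volume)
    (hcong : TranslationCongruent S (Set.Ioc 0 1)) :
    ∃ S₀ : Set ℝ, MeasurableSet S₀ ∧ S₀ =ᵐ[volume] S ∧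
      (∀ t ∈ S₀, ∀ m : ℤ, t + m ∈ S₀ → m = 0) ∧ ∀ᵐ t : ℝ, ∃ m : ℤ, t + m ∈ S₀ := by
  obtain ⟨S', J', hS', hJ', ρ, k, hρ, hk⟩ := hcong
  have hJ₁ : volume (J' \ Set.Ioc 0 1) = 0 := ae_le_set.1 hJ'.le
  have hJ₂ : volume (Set.Ioc 0 1 \ J') = 0 := ae_le_set.1 hJ'.symm.le
  set S'' : Set ℝ := {t ∈ S' | ρ t ∈ Set.Ioc 0 1} with hS''
  have hae : S'' =ᵐ[volume] S := by
    refine EventuallyEq.trans ?_ hS'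
    filter_upwards [ae_forall_add_intCast_notMem hJ₁] with t ht
    refine propext ⟨fun h => h.1, fun h => ⟨h, ?_⟩⟩
    by_contra hn
    exact ht (k t) ⟨hk t h ▸ hρ.mapsTo h, hk t h ▸ hn⟩
  obtain ⟨S₀, hsub, hm, hS₀⟩ := (hS.congr hae.symm).exists_measurable_subset_ae_eq
  refine ⟨S₀, hm, hS₀.trans hae, fun t ht m hm => ?_, ?_⟩
  · obtain ⟨h₁, h₁'⟩ := hsub ht
    obtain ⟨h₂, h₂'⟩ := hsub hm
    have heq : ρ t = ρ (t + m) := by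
      have e₁ := hk _ h₁
      have e₂ := hk _ h₂
      rw [e₁] at h₁' ⊢
      rw [e₂] at h₂' ⊢
      -- Both images lie in (0, 1] and differ by an integer, so they coincide.
      have hint : (k t : ℤ) = m + k (t + m) := by
        have l₁ : ((k t - (m + k (t + m)) : ℤ) : ℝ) < 1 := by
          push_cast; linarith [h₁'.2, h₂'.1]
        have l₂ : (-1 : ℝ) < ((k t - (m + k (t + m)) : ℤ) : ℝ) := by
          push_cast; linarith [h₁'.1, h₂'.2]
        have l₁' : k t - (m + k (t + m)) < 1 := by exact_mod_cast l₁
        have l₂' : -1 < k t - (m + k (t + m)) := by exact_mod_cast l₂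
        omega
      rw [hint]
      push_cast
      ring
    have := hρ.injOn h₁ h₂ heq
    exact_mod_cast (left_eq_add.1 this : (m : ℝ) = 0)
  · have hN : volume (S'' \ S₀) = 0 := ae_le_set.1 hS₀.symm.le
    filter_upwards [ae_forall_add_intCast_notMem hJ₂, ae_forall_add_intCast_notMem hN]
      with t h₁ h₂
    obtain ⟨m, hm, -⟩ := existsUnique_add_zsmul_mem_Ioc (one_pos (α := ℝ)) t 0
    rw [zsmul_one, zero_add] at hm
    have hJ : t + m ∈ J' := by
      by_contra hn
      exact h₁ m ⟨hm, hn⟩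
    obtain ⟨s, hs, hst⟩ := hρ.surjOn hJ
    have hsm : t + ((m - k s : ℤ) : ℝ) = s := by
      have := hk s hs
      push_cast
      linarith
    refine ⟨m - k s, ?_⟩
    by_contra hn
    refine h₂ (m - k s) ⟨?_, hn⟩
    rw [hsm]
    exact ⟨hs, hst ▸ hm⟩

theorem isAddFundamentalDomain_of_translates {S₀ : Set ℝ} (hm : MeasurableSet S₀)
    (hinj : ∀ t ∈ S₀, ∀ m : ℤ, t + m ∈ S₀ → m = 0) (hcov : ∀ᵐ t : ℝ, ∃ m : ℤ, t + m ∈ S₀) :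
    IsAddFundamentalDomain (AddSubgroup.zmultiples (1 : ℝ)).op S₀ volume := by
  refine IsAddFundamentalDomain.mk'' hm.nullMeasurableSet ?_ ?_ fun g => ?_
  · filter_upwards [hcov] with t ht
    obtain ⟨m, h⟩ := ht
    exact ⟨⟨AddOpposite.op (m : ℝ), ⟨m, by simp⟩⟩, h⟩
  · rintro ⟨g, m, hg⟩ hne
    refine Disjoint.aedisjoint (Set.disjoint_left.2 ?_)
    rintro _ ⟨t, ht, rfl⟩ h'
    have hg' : g.unop = (m : ℝ) := by
      rw [← hg]
      simp
    have hv : t + (m : ℝ) ∈ S₀ := by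
      rw [← hg']
      exact h'
    have hm0 := hinj t ht m hv
    refine hne (Subtype.ext (AddOpposite.unop_injective ?_))
    change g.unop = 0
    rw [hg', hm0, Int.cast_zero]
  · exact (measurePreserving_add_right (volume : Measure ℝ) g.1.unop).quasiMeasurePreserving

/-- In `ENNReal`, sums and integrals can be interchanged without summability conditions; finiteness
of ‖h‖² brings the identity back to the reals. -/
theorem hasSum_norm_sq_iff {ι E F : Type*} [NormedAddCommGroup E] [NormedAddCommGroup F]
    {a : ι → F} {h : E} :
    HasSum (fun i => ‖a i‖ ^ 2) (‖h‖ ^ 2) ↔ ∑' i, ‖a i‖ₑ ^ 2 = ‖h‖ₑ ^ 2 := by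
  have hF (x : F) : ‖x‖ₑ ^ 2 = ENNReal.ofReal (‖x‖ ^ 2) := by
    rw [ENNReal.ofReal_pow (norm_nonneg _), ofReal_norm]
  have hE : ‖h‖ₑ ^ 2 = ENNReal.ofReal (‖h‖ ^ 2) := by
    rw [ENNReal.ofReal_pow (norm_nonneg _), ofReal_norm]
  simp only [hF, hE]
  constructor
  · intro hs
    rw [← hs.tsum_eq, ENNReal.ofReal_tsum_of_nonneg (fun _ => by positivity) hs.summable]
  · intro hs
    have := ENNReal.hasSum_toReal (hs.trans_ne ENNReal.ofReal_ne_top)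
    rw [← ENNReal.tsum_toReal_eq (fun _ => ENNReal.ofReal_ne_top), hs] at this
    simpa [ENNReal.toReal_ofReal] using this

/-- Parseval's identity for Fourier series on a measurable set of representatives of `ℝ / ℤ`. -/
theorem tsum_enorm_sq_setIntegral_exp {S₀ : Set ℝ} (hm : MeasurableSet S₀)
    (hinj : ∀ t ∈ S₀, ∀ m : ℤ, t + m ∈ S₀ → m = 0) (hcov : ∀ᵐ t : ℝ, ∃ m : ℤ, t + m ∈ S₀)
    {c : ℝ → ℂ} (hc : MemLp c 2 (volume.restrict S₀)) :
    ∑' k : ℤ, ‖∫ t in S₀, Complex.exp (-(2 * Real.pi * Complex.I * k * t)) * c t‖ₑ ^ 2 =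
      ∫⁻ t in S₀, ‖c t‖ₑ ^ 2 := by
  set θ : S₀ → AddCircle (1 : ℝ) := fun t => ((t : ℝ) : AddCircle (1 : ℝ)) with hθ
  set ν : Measure S₀ := Measure.comap Subtype.val volume with hν
  have hsub := measurePreserving_subtype_coe (μa := (volume : Measure ℝ)) hm
  have hpres : MeasurePreserving θ ν volume :=
    (measurePreserving_quotientAddGroup_mk_of_AddQuotientMeasureEqMeasurePreimage volume
      (isAddFundamentalDomain_of_translates hm hinj hcov) _).comp hsub
  have hθinj : Function.Injective θ := by
    rintro ⟨s, hs⟩ ⟨t, ht⟩ h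
    obtain ⟨m, h'⟩ := QuotientAddGroup.eq.1 h
    have h'' : s + m = t := by
      simp only [zsmul_one] at h'
      linarith
    have := hinj s hs m (h'' ▸ ht)
    rw [this] at h''
    simpa using h''
  -- On a standard Borel space an injective measurable map is a measurable embedding, so integrals
  -- transfer along θ.
  have := hm.standardBorel
  have hemb : MeasurableEmbedding θ := hpres.measurable.measurableEmbedding hθinj
  -- The value 0 off the image of θ is immaterial, as that complement is null.
  set C : AddCircle (1 : ℝ) → ℂ := Function.extend θ (fun t => c t) 0 with hC
  have hCθ (t : S₀) : C (θ t) = c t := hθinj.extend_apply _ _ _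
  have hcν : MemLp (fun t : S₀ => c t) 2 ν := by
    have := hc
    rw [← hsub.map_eq] at this
    exact ((MeasurableEmbedding.subtype_coe hm).memLp_map_measure_iff).1 this
  have hCL : MemLp C 2 volume := by
    rw [← hpres.map_eq, hemb.memLp_map_measure_iff]
    exact hcν.ae_eq (Eventually.of_forall fun t => (hCθ t).symm)
  have hvol : (AddCircle.haarAddCircle : Measure (AddCircle (1 : ℝ))) = volume := by
    rw [AddCircle.volume_eq_smul_haarAddCircle]
    simp
  have hL := hCL.haarAddCircle
  have hcoeff (k : ℤ) : fourierCoeff hL.toLp k =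
      ∫ t in S₀, Complex.exp (-(2 * Real.pi * Complex.I * k * t)) * c t := by
    rw [fourierCoeff_congr_ae hL.coeFn_toLp, fourierCoeff, hvol, ← hpres.integral_comp hemb,
      ← integral_subtype_comap hm
        (fun t => Complex.exp (-(2 * Real.pi * Complex.I * k * t)) * c t)]
    refine integral_congr_ae (Eventually.of_forall fun t => ?_)
    simp only [hCθ]
    rw [hθ, fourier_coe_apply, smul_eq_mul]
    congr 2
    push_cast
    ring
  have hsum : HasSum (fun k => ‖fourierCoeff hL.toLp k‖ ^ 2) (‖hL.toLp‖ ^ 2) := by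
    simp_rw [← fourierBasis_repr]
    rw [← LinearIsometryEquiv.norm_map fourierBasis.repr hL.toLp]
    exact_mod_cast lp.hasSum_norm (by simp) (fourierBasis.repr hL.toLp)
  have hnorm : ∫⁻ t in S₀, ‖c t‖ₑ ^ 2 = ‖hL.toLp‖ₑ ^ 2 := by
    rw [Lp.enorm_toLp, ← lintegral_enorm_sq_eq_enorm_sq, hvol, ← hpres.lintegral_comp_emb hemb]
    simp only [hCθ]
    rw [← hsub.map_eq, (MeasurableEmbedding.subtype_coe hm).lintegral_map]
  rw [hnorm, ← hasSum_norm_sq_iff.1 hsum]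
  simp only [hcoeff]

/-! ### Parseval identities on dense subsets -/

/-- If the Parseval identity holds on a dense subset, it holds everywhere. -/
theorem tsum_enorm_inner_sq_of_dense {ι E : Type*} [Countable ι] [NormedAddCommGroup E] [InnerProductSpace ℂ E]
    {x : ι → E} {D : Set E} (hD : Dense D)
    (h : ∀ d ∈ D, ∑' i, ‖inner ℂ (x i) d‖ₑ ^ 2 = ‖d‖ₑ ^ 2) (y : E) :
    ∑' i, ‖inner ℂ (x i) y‖ₑ ^ 2 = ‖y‖ₑ ^ 2 := by
  -- With the discrete σ-algebra and counting measure, N is the ℓ² norm of the coefficients, and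
  -- Minkowski's inequality is available for it.
  let _ : MeasurableSpace ι := ⊤
  set N : E → ENNReal := fun y => eLpNorm (fun i => inner ℂ (x i) y) 2 Measure.count with hN
  have hNsq (y : E) : ∑' i, ‖inner ℂ (x i) y‖ₑ ^ 2 = N y ^ 2 := by
    rw [hN, ← lintegral_enorm_sq_eq_enorm_sq, lintegral_count]
  -- Bessel's inequality extends from D since each finite partial sum is continuous.
  have hle (y : E) : N y ≤ ‖y‖ₑ := by
    rw [← ENNReal.pow_le_pow_left_iff two_ne_zero, ← hNsq, ENNReal.tsum_eq_iSup_sum]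
    refine iSup_le fun s => ?_
    have hc : IsClosed {y : E | ∑ i ∈ s, ‖inner ℂ (x i) y‖ₑ ^ 2 ≤ ‖y‖ₑ ^ 2} := by
      refine isClosed_le ?_ ((ENNReal.continuous_pow 2).comp continuous_enorm)
      refine continuous_finsetSum _ fun i _ => (ENNReal.continuous_pow 2).comp ?_
      exact continuous_enorm.comp (continuous_const.inner continuous_id)
    exact hc.closure_subset_iff.2 (fun d hd => (ENNReal.sum_le_tsum s).trans_eq (h d hd)) (hD y)
  have hDN {d : E} (hd : d ∈ D) : N d = ‖d‖ₑ :=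
    (ENNReal.pow_right_strictMono two_ne_zero).injective ((hNsq d).symm.trans (h d hd))
  rw [hNsq]
  congr 1
  refine le_antisymm (hle y) ?_
  -- On D this inequality is Minkowski plus Bessel; being closed in d, it also holds at d = y, where
  -- it is the missing lower bound.
  have hc : IsClosed {d : E | ‖d‖ₑ ≤ N y + ‖d - y‖ₑ} :=
    isClosed_le continuous_enorm
      (continuous_const.add (continuous_enorm.comp (continuous_id.sub continuous_const)))
  have hy := hc.closure_subset_iff.2 (fun d hd => ?_) (hD y)
  · simpa using hy
  · rw [Set.mem_ofPred_eq, ← hDN hd]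
    have : (fun i => inner ℂ (x i) d) = (fun i => inner ℂ (x i) y) +
        fun i => inner ℂ (x i) (d - y) := by
      funext i
      rw [Pi.add_apply, ← inner_add_right, add_sub_cancel]
    calc N d ≤ N y + N (d - y) := by
          rw [hN]
          simp only
          rw [this]
          exact eLpNorm_add_le (StronglyMeasurable.of_discrete).aestronglyMeasurable
            (StronglyMeasurable.of_discrete).aestronglyMeasurable one_le_two
      _ ≤ N y + ‖d - y‖ₑ := by gcongr; exact hle _

/-! ### The lattices -/

namespace Heisenberg

instance countable_Lam₁ : Countable Lam₁ := by
  have : Lam₁ = Set.range fun q : ℤ × ℤ × ℤ × ℤ =>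
      ((⟨q.2.1, q.1, 0⟩, ⟨q.2.2.2, q.2.2.1, 0⟩) : Heisenberg × Heisenberg) := by
    ext p
    constructor
    · rintro ⟨k₂, k₃, m₂, m₃, rfl⟩
      exact ⟨(k₂, k₃, m₂, m₃), rfl⟩
    · rintro ⟨⟨k₂, k₃, m₂, m₃⟩, rfl⟩
      exact ⟨k₂, k₃, m₂, m₃, rfl⟩
  rw [this]
  exact (Set.countable_range _).to_subtype

/-- The product of an element of `Lam₁` with the central element `M(0, 0, k)`. -/
def centralTranslate (q : ℤ × Lam₁) : Lam :=
  ⟨(⟨q.2.1.1.x, q.2.1.1.y, q.1⟩, q.2.1.2), by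
    obtain ⟨k, ⟨p, k₂, k₃, m₂, m₃, rfl⟩⟩ := q
    exact ⟨k, k₂, k₃, m₂, m₃, rfl⟩⟩

theorem z_eq_zero (p : Lam₁) : p.1.1.z = 0 := by
  obtain ⟨_, k₂, k₃, m₂, m₃, rfl⟩ := p
  rfl

theorem bijective_centralTranslate : Function.Bijective centralTranslate := by
  constructor
  · rintro ⟨k, p⟩ ⟨l, q⟩ h
    have h' := congrArg Subtype.val h
    simp only [centralTranslate, Prod.mk.injEq, Heisenberg.mk.injEq, Int.cast_inj] at h'
    obtain ⟨⟨hx, hy, hk⟩, h₂⟩ := h'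
    refine Prod.ext hk (Subtype.ext (Prod.ext (Heisenberg.ext hx hy ?_) h₂))
    rw [z_eq_zero, z_eq_zero]
  · rintro ⟨_, k₁, k₂, k₃, m₂, m₃, rfl⟩
    exact ⟨(k₁, ⟨_, k₂, k₃, m₂, m₃, rfl⟩), rfl⟩

end Heisenberg

theorem schrodinger_central (lam x y z s : ℝ) (u : L2R) :
    schrodinger lam ⟨x, y, z + s⟩ u =
      Complex.exp (2 * Real.pi * Complex.I * lam * s) • schrodinger lam ⟨x, y, z⟩ u := by
  apply Lp.ext
  filter_upwards [coeFn_schrodinger lam ⟨x, y, z + s⟩ u, coeFn_schrodinger lam ⟨x, y, z⟩ u,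
    Lp.coeFn_smul (Complex.exp (2 * Real.pi * Complex.I * lam * s))
      (schrodinger lam ⟨x, y, z⟩ u)] with t h₁ h₂ h₃
  rw [h₁, h₃, Pi.smul_apply, h₂]
  simp only [schrodingerFun, smul_eq_mul, ← mul_assoc, ← Complex.exp_add]
  congr 2
  push_cast
  ring

theorem tensorRep_central (lam x y s : ℝ) (η : Heisenberg) (T : L2Tensor) :
    tensorRep lam ⟨x, y, s⟩ η T =
      Complex.exp (2 * Real.pi * Complex.I * lam * s) • tensorRep lam ⟨x, y, 0⟩ η T := by
  refine ext_matrixCoeff fun u v => ?_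
  have hv : schrodinger lam (⟨x, y, s⟩ : Heisenberg)⁻¹ v =
      Complex.exp (2 * Real.pi * Complex.I * lam * (-s : ℝ)) •
        schrodinger lam (⟨x, y, 0⟩ : Heisenberg)⁻¹ v := by
    rw [Heisenberg.inv_def, Heisenberg.inv_def, ← schrodinger_central]
    congr 3
    simp only
    ring
  have hsmul (c : ℂ) (X : L2Tensor) : matrixCoeff (c • X) u v = c * matrixCoeff X u v :=
    inner_smul_right _ _ _
  rw [hsmul, matrixCoeff_tensorRep, matrixCoeff_tensorRep, hv, matrixCoeff, matrixCoeff]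
  change inner ℂ (pureTensorₗ (_ • _) _) T = _ * inner ℂ (pureTensorₗ _ _) T
  rw [map_smul, LinearMap.smul_apply, inner_smul_left, ← Complex.exp_conj]
  congr 2
  simp only [map_mul, Complex.conj_I, Complex.conj_ofReal, map_ofNat]
  push_cast
  ring

/-! ### Necessary condition for Parseval frames -/

theorem inversePlancherel_indicator_mem {S A : Set ℝ} (hA : MeasurableSet A)
    (hμA : plancherelMeasure A ≠ ⊤) (hAS : ∀ᵐ lam : ℝ, lam ∈ A → lam ∈ S) (w : L2Tensor) :
    inversePlancherel (indicatorConstLp 2 hA hμA w) ∈ bandlimitedSpace S := by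
  change ∀ᵐ lam : ℝ, lam ∉ S → plancherel _ lam = 0
  rw [plancherel_eq, plancherelCLM_inversePlancherel]
  filter_upwards [ae_plancherelMeasure_iff.1
    (indicatorConstLp_coeFn (p := 2) (hs := hA) (hμs := hμA) (c := w)), hAS] with lam h₁ h₂ h₃
  rw [h₁, Set.indicator_of_notMem (fun h => h₃ (h₂ h))]

theorem inner_inversePlancherel_indicator {A : Set ℝ} (hA : MeasurableSet A)
    (hμA : plancherelMeasure A ≠ ⊤) (w : L2Tensor) (f : Heisenberg.L2) :
    inner ℂ (inversePlancherel (indicatorConstLp 2 hA hμA w)) f =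
      ∫ lam in A, ((|lam| : ℝ) : ℂ) * inner ℂ w (plancherelCLM f lam) := by
  rw [← inner_plancherelCLM, L2.inner_indicatorConstLp_eq_setIntegral_inner,
    ← integral_indicator hA, ← integral_indicator hA, integral_plancherelMeasure]
  refine integral_congr_ae (Eventually.of_forall fun lam => ?_)
  by_cases h : lam ∈ A <;> simp [h]

/-- Fourier series need square integrability for dλ, whereas Ψ is square integrable for |λ| dλ. On a
bounded set |λ|² ≤ N|λ| bridges the two. -/
theorem memLp_abs_mul_inner (N : ℝ) {A : Set ℝ} (hA : MeasurableSet A)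
    (hAN : ∀ lam ∈ A, |lam| ≤ N) (w : L2Tensor) (Ψ : PlancherelSpace) :
    MemLp (A.indicator fun lam : ℝ => ((|lam| : ℝ) : ℂ) * inner ℂ w (Ψ lam)) 2 volume := by
  have hm : Measurable fun lam => inner ℂ w (Ψ lam) :=
    (stronglyMeasurable_const.inner (Lp.stronglyMeasurable Ψ)).measurable
  have hm' : Measurable fun lam : ℝ => ((|lam| : ℝ) : ℂ) * inner ℂ w (Ψ lam) :=
    Measurable.mul (by fun_prop) hm
  refine ⟨(hm'.indicator hA).aestronglyMeasurable, ?_⟩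
  refine ((ENNReal.pow_lt_top_iff (n := 2)).1 ?_).resolve_right two_ne_zero
  rw [← lintegral_enorm_sq_eq_enorm_sq]
  have hbound (lam : ℝ) : ‖A.indicator (fun lam : ℝ => ((|lam| : ℝ) : ℂ) * inner ℂ w (Ψ lam)) lam‖ₑ
      ^ 2 ≤ ENNReal.ofReal N * (ENNReal.ofReal |lam| * ‖inner ℂ w (Ψ lam)‖ₑ ^ 2) := by
    by_cases h : lam ∈ A
    · rw [Set.indicator_of_mem h, enorm_mul, mul_pow, ← ofReal_norm ((|lam| : ℝ) : ℂ),
        Complex.norm_real, Real.norm_eq_abs, abs_abs, pow_two (ENNReal.ofReal |lam|), mul_assoc]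
      gcongr
      exact hAN lam h
    · simp [h]
  refine (lintegral_mono hbound).trans_lt ?_
  have hg : Measurable fun lam : ℝ => ENNReal.ofReal |lam| * ‖inner ℂ w (Ψ lam)‖ₑ ^ 2 :=
    measurable_ofReal_abs.mul (hm.enorm.pow_const 2)
  rw [lintegral_const_mul _ hg,
    ← lintegral_plancherelMeasure (hm.enorm.pow_const 2), lintegral_enorm_sq_eq_enorm_sq]
  exact ENNReal.mul_lt_top ENNReal.ofReal_lt_top
    (ENNReal.pow_lt_top (memLp_inner_const w Ψ).2)

theorem plancherelCLM_biregular_centralTranslate (f : Heisenberg.L2) (k : ℤ)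
    (p : Heisenberg.Lam₁) :
    ∀ᵐ lam : ℝ, plancherelCLM (Heisenberg.biregular
        (Heisenberg.centralTranslate (k, p)).1.1 (Heisenberg.centralTranslate (k, p)).1.2 f) lam =
      Complex.exp (2 * Real.pi * Complex.I * k * lam) •
        plancherelCLM (Heisenberg.biregular p.1.1 p.1.2 f) lam := by
  filter_upwards [plancherelCLM_biregular (Heisenberg.centralTranslate (k, p)).1.1
    (Heisenberg.centralTranslate (k, p)).1.2 f, plancherelCLM_biregular p.1.1 p.1.2 f]
    with lam h₁ h₂
  rw [h₁, h₂]
  have hp : p.1.1 = ⟨p.1.1.x, p.1.1.y, 0⟩ := by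
    rw [← Heisenberg.z_eq_zero p]
  change tensorRep lam ⟨p.1.1.x, p.1.1.y, (k : ℝ)⟩ p.1.2 _ = _
  rw [tensorRep_central, ← hp]
  congr 2
  push_cast
  ring

section Frame

variable {S : Set ℝ} {f : Heisenberg.L2}

/-- The Parseval identity tested against `λ ↦ 1_A(λ) w`. -/
theorem setLIntegral_tsum_of_isParsevalFrame {S₀ : Set ℝ} (hm : MeasurableSet S₀)
    (hS₀ : S₀ =ᵐ[volume] S) (hinj : ∀ t ∈ S₀, ∀ m : ℤ, t + m ∈ S₀ → m = 0)
    (hcov : ∀ᵐ t : ℝ, ∃ m : ℤ, t + m ∈ S₀)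
    (hframe : IsParsevalFrame (bandlimitedSpace S)
      (fun p : Heisenberg.Lam => Heisenberg.biregular p.1.1 p.1.2 f))
    {N : ℝ} {A : Set ℝ} (hA : MeasurableSet A) (hAS : A ⊆ S₀) (hAN : ∀ lam ∈ A, |lam| ≤ N)
    (w : L2Tensor) :
    ∫⁻ lam in A, ∑' p : Heisenberg.Lam₁, ‖((|lam| : ℝ) : ℂ) *
        inner ℂ w (plancherelCLM (Heisenberg.biregular p.1.1 p.1.2 f) lam)‖ₑ ^ 2 =
      ∫⁻ lam in A, ENNReal.ofReal |lam| * ‖w‖ₑ ^ 2 := by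
  have hμA : plancherelMeasure A ≠ ⊤ :=
    ((measure_mono fun lam h => abs_le.1 (hAN lam h)).trans_lt
      (isCompact_Icc (a := -N) (b := N)).measure_lt_top).ne
  set h := inversePlancherel (indicatorConstLp 2 hA hμA w) with hh
  have hmem : h ∈ bandlimitedSpace S :=
    inversePlancherel_indicator_mem hA hμA
      (hS₀.mem_iff.mono fun lam e hl => e.1 (hAS hl)) w
  set c : Heisenberg.Lam₁ → ℝ → ℂ := fun p lam => ((|lam| : ℝ) : ℂ) *
    inner ℂ w (plancherelCLM (Heisenberg.biregular p.1.1 p.1.2 f) lam) with hc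
  have hmeas (p : Heisenberg.Lam₁) : Measurable (c p) :=
    Measurable.mul (by fun_prop)
      (stronglyMeasurable_const.inner (Lp.stronglyMeasurable _)).measurable
  -- The central character contributes e^{+2πikλ}, so the coefficient is the Fourier coefficient of
  -- index -k; the sum over all integers is unaffected.
  have hcoef (k : ℤ) (p : Heisenberg.Lam₁) :
      ‖inner ℂ (Heisenberg.biregular (Heisenberg.centralTranslate (k, p)).1.1
        (Heisenberg.centralTranslate (k, p)).1.2 f) h‖ₑ =
      ‖∫ t in S₀, Complex.exp (-(2 * Real.pi * Complex.I * ((-k : ℤ) : ℂ) * t)) *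
        A.indicator (c p) t‖ₑ := by
    rw [← ofReal_norm, ← ofReal_norm, norm_inner_symm, hh, inner_inversePlancherel_indicator]
    congr 2
    rw [← integral_indicator hA, ← integral_indicator hm]
    refine integral_congr_ae ?_
    filter_upwards [plancherelCLM_biregular_centralTranslate f k p] with lam hl
    by_cases hlA : lam ∈ A
    · rw [Set.indicator_of_mem hlA, Set.indicator_of_mem (hAS hlA), Set.indicator_of_mem hlA, hl,
        inner_smul_right, hc]
      have : -(2 * Real.pi * Complex.I * ((-k : ℤ) : ℂ) * lam) =
          2 * Real.pi * Complex.I * k * lam := by push_cast; ring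
      rw [this]
      ring
    · by_cases hlS : lam ∈ S₀ <;> simp [hlA, hlS]
  have hk (p : Heisenberg.Lam₁) : ∑' k : ℤ,
      ‖inner ℂ (Heisenberg.biregular (Heisenberg.centralTranslate (k, p)).1.1
        (Heisenberg.centralTranslate (k, p)).1.2 f) h‖ₑ ^ 2 = ∫⁻ lam in A, ‖c p lam‖ₑ ^ 2 := by
    simp only [hcoef]
    have hneg := (Equiv.neg ℤ).tsum_eq fun k : ℤ =>
      ‖∫ t in S₀, Complex.exp (-(2 * Real.pi * Complex.I * k * t)) * A.indicator (c p) t‖ₑ ^ 2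
    simp only [Equiv.neg_apply] at hneg
    rw [hneg,
      tsum_enorm_sq_setIntegral_exp hm hinj hcov
        ((memLp_abs_mul_inner N hA hAN w _).restrict S₀),
      ← lintegral_indicator hm, ← lintegral_indicator hA]
    refine lintegral_congr fun lam => ?_
    by_cases hlA : lam ∈ A
    · simp [hlA, hAS hlA, hc]
    · by_cases hlS : lam ∈ S₀ <;> simp [hlA, hlS]
  have hsum := hasSum_norm_sq_iff.1 (hframe.2 h hmem)
  -- The sum over Λ is regrouped over ℤ × Λ₁ with the central index k innermost, where Parseval on
  -- S₀ applies.
  rw [← (Equiv.ofBijective _ Heisenberg.bijective_centralTranslate).tsum_eq,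
    ENNReal.tsum_prod', ENNReal.tsum_comm] at hsum
  simp only [Equiv.ofBijective_apply, hk] at hsum
  rw [lintegral_tsum fun p => ((hmeas p).enorm.pow_const 2).aemeasurable, hsum, hh,
    LinearIsometry.enorm_map, lintegral_mul_const _ measurable_ofReal_abs, Lp.enorm_def,
    eLpNorm_congr_ae indicatorConstLp_coeFn, ← lintegral_enorm_sq_eq_enorm_sq]
  have hind : (fun lam => ‖A.indicator (fun _ => w) lam‖ₑ ^ 2) =
      A.indicator fun _ => ‖w‖ₑ ^ 2 := by
    funext lam
    by_cases hlA : lam ∈ A <;> simp [hlA]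
  rw [hind, lintegral_indicator hA, setLIntegral_const, plancherelMeasure,
    withDensity_apply _ hA, mul_comm]

/-- Integrals over all measurable subsets of S₀ ∩ [-N, N] determine the integrand almost everywhere.
The left side carries |λ|², one factor from the Plancherel measure in each coefficient before
squaring, while ‖h‖² carries |λ|; cancelling one leaves the normalization √|λ|. -/
theorem ae_tsum_enorm_inner_tensorRep {S₀ : Set ℝ} (hm : MeasurableSet S₀)
    (hS₀ : S₀ =ᵐ[volume] S) (hinj : ∀ t ∈ S₀, ∀ m : ℤ, t + m ∈ S₀ → m = 0)
    (hcov : ∀ᵐ t : ℝ, ∃ m : ℤ, t + m ∈ S₀)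
    (hframe : IsParsevalFrame (bandlimitedSpace S)
      (fun p : Heisenberg.Lam => Heisenberg.biregular p.1.1 p.1.2 f)) (w : L2Tensor) :
    ∀ᵐ lam : ℝ, lam ∈ S₀ → ∑' p : Heisenberg.Lam₁, ‖inner ℂ (tensorRep lam p.1.1 p.1.2
      (((Real.sqrt |lam| : ℝ) : ℂ) • plancherelCLM f lam)) w‖ₑ ^ 2 = ‖w‖ₑ ^ 2 := by
  have hmeas : Measurable fun lam : ℝ => ∑' p : Heisenberg.Lam₁, ‖((|lam| : ℝ) : ℂ) *
      inner ℂ w (plancherelCLM (Heisenberg.biregular p.1.1 p.1.2 f) lam)‖ₑ ^ 2 := by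
    refine Measurable.tsum fun p => Measurable.pow_const (Measurable.enorm ?_) 2
    exact Measurable.mul (by fun_prop)
      (stronglyMeasurable_const.inner (Lp.stronglyMeasurable _)).measurable
  have hN (N : ℕ) : ∀ᵐ lam : ℝ, lam ∈ S₀ ∩ Set.Icc (-(N : ℝ)) N →
      ∑' p : Heisenberg.Lam₁, ‖((|lam| : ℝ) : ℂ) *
        inner ℂ w (plancherelCLM (Heisenberg.biregular p.1.1 p.1.2 f) lam)‖ₑ ^ 2 =
      ENNReal.ofReal |lam| * ‖w‖ₑ ^ 2 := by
    have hmN : MeasurableSet (S₀ ∩ Set.Icc (-(N : ℝ)) N) := hm.inter measurableSet_Icc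
    rw [← ae_restrict_iff' hmN]
    refine ae_eq_of_forall_setLIntegral_eq_of_sigmaFinite hmeas
      (measurable_ofReal_abs.mul_const _) fun s hs _ => ?_
    rw [Measure.restrict_restrict hs]
    exact setLIntegral_tsum_of_isParsevalFrame hm hS₀ hinj hcov hframe (hs.inter hmN)
      (fun lam h => h.2.1) (N := N) (fun lam h => abs_le.2 h.2.2) w
  have h0 : ∀ᵐ lam : ℝ, lam ≠ 0 := by simp [ae_iff, measure_singleton]
  have heq : ∀ᵐ lam : ℝ, ∀ p : Heisenberg.Lam₁,
      plancherelCLM (Heisenberg.biregular p.1.1 p.1.2 f) lam =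
        tensorRep lam p.1.1 p.1.2 (plancherelCLM f lam) :=
    ae_all_iff.2 fun p => plancherelCLM_biregular _ _ _
  filter_upwards [ae_all_iff.2 hN, h0, heq] with lam h₁ h₂ h₃ h₄
  obtain ⟨N, hle⟩ := exists_nat_ge |lam|
  have key := h₁ N ⟨h₄, abs_le.1 hle⟩
  have hc0 : ENNReal.ofReal |lam| ≠ 0 := by simpa using h₂
  rw [← ENNReal.mul_right_inj hc0 ENNReal.ofReal_ne_top, ← key, ← ENNReal.tsum_mul_left]
  refine tsum_congr fun p => ?_
  have hsqrt : ‖((Real.sqrt |lam| : ℝ) : ℂ)‖ₑ ^ 2 = ENNReal.ofReal |lam| := by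
    rw [← ofReal_norm, Complex.norm_real, Real.norm_of_nonneg (Real.sqrt_nonneg _),
      ← ENNReal.ofReal_pow (Real.sqrt_nonneg _), Real.sq_sqrt (abs_nonneg _)]
  have habs : ‖((|lam| : ℝ) : ℂ)‖ₑ = ENNReal.ofReal |lam| := by
    rw [← ofReal_norm, Complex.norm_real, Real.norm_eq_abs, abs_abs]
  have hsymm : ‖inner ℂ (tensorRep lam p.1.1 p.1.2 (plancherelCLM f lam)) w‖ₑ =
      ‖inner ℂ w (tensorRep lam p.1.1 p.1.2 (plancherelCLM f lam))‖ₑ := by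
    rw [← ofReal_norm, ← ofReal_norm, norm_inner_symm]
  rw [h₃, map_smul, inner_smul_left, enorm_mul, enorm_mul, RCLike.enorm_conj, mul_pow, mul_pow,
    hsqrt, habs, hsymm]
  ring

end Frame

end

theorem theorem1p2 (S : Set ℝ) (hS : NullMeasurableSet S volume)
    (hcong : TranslationCongruent S (Set.Ioc 0 1))
    (f : Heisenberg.L2) (hf : f ∈ bandlimitedSpace S)
    (hframe : IsParsevalFrame (bandlimitedSpace S)
      (fun p : Heisenberg.Lam => Heisenberg.biregular p.1.1 p.1.2 f)) :
    ∀ᵐ lam : ℝ, lam ∈ S →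
      IsParsevalFrame (Set.univ : Set L2Tensor)
        (fun p : Heisenberg.Lam₁ =>
          tensorRep lam p.1.1 p.1.2 (((Real.sqrt |lam| : ℝ) : ℂ) • plancherel f lam)) := by
  obtain ⟨S₀, hm, hS₀, hinj, hcov⟩ := exists_measurableSet_of_translationCongruent hS hcong
  -- The exceptional null set depends on w, so only a dense sequence of w is used before λ is fixed.
  have hall := ae_all_iff.2 fun n => ae_tsum_enorm_inner_tensorRep hm hS₀ hinj hcov hframe
    (TopologicalSpace.denseSeq L2Tensor n)
  filter_upwards [hall, hS₀.mem_iff] with lam h hl hlS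
  have hl₀ : lam ∈ S₀ := hl.2 hlS
  refine ⟨fun _ => Set.mem_univ _, fun w _ => hasSum_norm_sq_iff.2 ?_⟩
  rw [plancherel_eq]
  refine tsum_enorm_inner_sq_of_dense (TopologicalSpace.denseRange_denseSeq L2Tensor) ?_ w
  rintro _ ⟨n, rfl⟩
  exact h n hl₀
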